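/- Let $\mathbb F_q$ be a finite field. Let $\Gamma\subset\mathbb Z_{\ge 0}^r$ be a finitely generated subsemigroup containing $0$, equipped with a well-order $\prec$ such that $\alpha\prec\beta$ implies $\alpha+\gamma\prec\beta+\gamma$. An \emph{order domain with value semigroup $\Gamma$} is a commutative $\mathbb F_q$-algebra $R$ with a surjective map $\rho:R\to\{-\infty\}\cup\Gamma$ such that for all $f,g\in R$: (1) $\rho(f)=-\infty$ if and only if $f=0$; (2) $\rho(cf)=\rho(f)$ for $0\ne c\in\mathbb F_q$; (3) $\rho(f+g)\preceq\max\{\rho(f),\rho(g)\}$; (4) if $\rho(f)=\rho(g)\neq-\infty$, then $\rho(f-cg)\prec\rho(f)$ for some $0\ne c\in\mathbb F_q$; (5) $\rho(fg)=\rho(f)+\rho(g)$. Let $R_\Gamma=\mathbb F_q[\Gamma]\subset\mathbb F_q[T_1,\dots,T_r]$ be the subalgebra generated by the monomials $T^\gamma$, $\gamma\in\Gamma$. We say that $R$ \emph{has a flat deformation to} $R_\Gamma$ if there is a finitely generated commutative $\mathbb F_q[t]$-algebra $A$, flat over $\mathbb F_q[t]$, with $A/tA\cong R_\Gamma$ as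 $\mathbb F_q$-algebras and $\mathbb F_q[t,t^{-1}]\otimes_{\mathbb F_q[t]}A\cong \mathbb F_q[t,t^{-1}]\otimes_{\mathbb F_q}R$ as $\mathbb F_q[t,t^{-1}]$-algebras. For generators $\gamma_1,\dots,\gamma_s$ of $\Gamma$ let $M$ be the matrix with columns $\gamma_1,\dots,\gamma_s$, call $M\alpha=\sum_i\alpha_i\gamma_i\in\Gamma$ the weight of $X^\alpha$, and let $I_\Gamma\subset\mathbb F_q[X_1,\dots,X_s]$ be the ideal generated by all $X^\alpha-X^\beta$ with $M\alpha=M\beta$. For a monomial order $\tau$ let $>_{M,\tau}$ be the monomial order that compares first the weights by $\prec$ and breaks ties by $\tau$. An ideal $I\subset\mathbb F_q[X_1,\dots,X_s]$ is of \emph{Geil--Pellikaan form} for $(M,\tau)$ if every element of its reduced Gröbner basis for $>_{M,\tau}$ has exactly two monomials of highest weight in its support, and the standard monomials (those which are not leading monomials of nonzero elements of $I$) have distinct weights. \textbf{Theorem.} (a) Every order domain $R$ with value semigroup $\Gamma$ has a flat deformation to $R_\Gamma$. Moreover, for all generators $\gamma_1,\dots,\gamma_s$ of $\Gamma$ one has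 $\mathbb F_q[X_1,\dots,X_s]/I_\Gamma\cong R_\Gamma$ via $X_i\mapsto T^{\gamma_i}$, and for every $\tau$ there is an ideal $I$ of Geil--Pellikaan form for $(M,\tau)$ with $R\cong\mathbb F_q[X_1,\dots,X_s]/I$. (b) Conversely, for all generators $\gamma_1,\dots,\gamma_s$ of $\Gamma$ and every $\tau$, if $I$ is of Geil--Pellikaan form for $(M,\tau)$, then $\mathbb F_q[X_1,\dots,X_s]/I$ is an order domain with value semigroup $\Gamma$, with order function $\rho$ given as follows: if $f$ is a linear combination of standard monomials, then $\rho(f)$ is the maximal weight of a monomial in the support of $f$ (and $-\infty$ if $f=0$). -/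

import Mathlib

open scoped TensorProduct LaurentPolynomial

noncomputable section

/-- A well-ordered commutative semigroup (with zero): the total order is strictly compatible with
addition and every nonempty subset has a least element. -/
structure IsWellOrderedSemigroup (S : Type*) [AddCommMonoid S] [LinearOrder S] : Prop where
  add_lt_add : ∀ a b c : S, a < b → a + c < b + c
  wf : WellFounded (fun a b : S => a < b)

/-- `ρ : R → {-∞} ∪ S` is an order function on the `F`-algebra `R` with value semigroup `S`. -/
structure IsOrderFunction (F : Type*) [Field F] {R : Type*} [CommRing R] [Algebra F R]
    {S : Type*} [AddCommMonoid S] [LinearOrder S] (ρ : R → WithBot S) : Prop where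
  surjective : Function.Surjective ρ
  eq_bot_iff : ∀ f : R, ρ f = ⊥ ↔ f = 0
  smul : ∀ (c : F) (f : R), c ≠ 0 → ρ (c • f) = ρ f
  add_le : ∀ f g : R, ρ (f + g) ≤ max (ρ f) (ρ g)
  exists_sub_lt : ∀ f g : R, ρ f = ρ g → ρ f ≠ ⊥ → ∃ c : F, c ≠ 0 ∧ ρ (f - c • g) < ρ f
  mul : ∀ f g : R, ρ (f * g) = ρ f + ρ g

/-- The monomial `T^γ` in `F[T₁, …, T_r]`. -/
def toricMonomial (F : Type*) [Field F] {r : ℕ} (γ : Fin r → ℕ) : MvPolynomial (Fin r) F :=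
  ∏ i, MvPolynomial.X i ^ γ i

/-- The toric algebra `R_Γ = F[Γ]`: the subring of `F[T₁, …, T_r]` generated over `F` by the
monomials `T^γ` with `γ ∈ Γ`. -/
def toricAlgebra (F : Type*) [Field F] {r : ℕ} (Γ : AddSubmonoid (Fin r → ℕ)) :
    Subalgebra F (MvPolynomial (Fin r) F) :=
  Algebra.adjoin F (toricMonomial F '' (Γ : Set (Fin r → ℕ)))

/-- The weight of the monomial `X^α` for the weights `γ₁, …, γ_s`: the element
`α₁ γ₁ + ⋯ + α_s γ_s`. It is `M α` if `M` is the matrix with columns `γ₁, …, γ_s`. -/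
def monWeight {S : Type*} [AddCommMonoid S] {s : ℕ} (γ : Fin s → S) : (Fin s →₀ ℕ) →+ S :=
  Finsupp.weight γ

/-- The toric ideal: generated by the binomials `X^α - X^β` with `M α = M β`. -/
def toricIdeal (F : Type*) [Field F] {S : Type*} [AddCommMonoid S] {s : ℕ} (γ : Fin s → S) :
    Ideal (MvPolynomial (Fin s) F) :=
  Ideal.span {p | ∃ α β : Fin s →₀ ℕ, monWeight γ α = monWeight γ β ∧
    p = MvPolynomial.monomial α 1 - MvPolynomial.monomial β 1}

/-- `Spec A → Spec F[t]` is a flat family whose fibre over `t = 0` is `R₀` and whose restriction to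
the punctured line `t ≠ 0` is the constant family with fibre `R`. -/
structure IsFlatDeformation (F : Type*) [Field F] (A : Type*) [CommRing A]
    [Algebra (Polynomial F) A] [Algebra F A] (R : Type*) [CommRing R] [Algebra F R]
    (R₀ : Type*) [CommRing R₀] [Algebra F R₀] : Prop where
  flat : Module.Flat (Polynomial F) A
  special : Nonempty
    ((A ⧸ Ideal.span {algebraMap (Polynomial F) A Polynomial.X}) ≃ₐ[F] R₀)
  general : Nonempty (F[T;T⁻¹] ⊗[Polynomial F] A ≃ₐ[F[T;T⁻¹]] F[T;T⁻¹] ⊗[F] R)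

/-- `R` has a flat deformation to `R₀`, through a family of affine schemes
`A = F[t][X₁, …, X_n] / J` of finite type over the affine line. -/
def HasFlatDeformation (F : Type*) [Field F] (R : Type*) [CommRing R] [Algebra F R]
    (R₀ : Type*) [CommRing R₀] [Algebra F R₀] : Prop :=
  ∃ (n : ℕ) (J : Ideal (MvPolynomial (Fin n) (Polynomial F))),
    IsFlatDeformation F (MvPolynomial (Fin n) (Polynomial F) ⧸ J) R R₀

theorem IsWellOrderedSemigroup.zero_le {S : Type*} [AddCommMonoid S] [LinearOrder S]
    (hS : IsWellOrderedSemigroup S) (a : S) : 0 ≤ a := by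
  by_contra h
  rw [not_le] at h
  have hmin : ∀ x : S, x + a < x := fun x => by
    have := hS.add_lt_add a 0 x h
    rwa [zero_add, add_comm] at this
  exact hS.wf.induction (C := fun _ => False) a fun x ih => ih (x + a) (hmin x)

/-- The exponents, as a type of its own that carries the order of `weightOrder`. -/
structure WeightSyn (s : ℕ) where
  /-- the underlying exponent -/
  val : Fin s →₀ ℕ

/-- `WeightSyn s` is a copy of the exponents. -/
def WeightSyn.equiv (s : ℕ) : WeightSyn s ≃ (Fin s →₀ ℕ) where
  toFun := WeightSyn.val
  invFun := WeightSyn.mk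
  left_inv _ := rfl
  right_inv _ := rfl

instance (s : ℕ) : AddCommMonoid (WeightSyn s) := (WeightSyn.equiv s).addCommMonoid

/-- The pair (weight, tie-breaker) by which exponents are compared lexicographically. -/
def weightKey {S : Type*} [AddCommMonoid S] {s : ℕ} (γ : Fin s → S)
    (τ : MonomialOrder (Fin s)) (a : WeightSyn s) : S ×ₗ τ.syn :=
  toLex (monWeight γ a.val, τ.toSyn a.val)

theorem weightKey_injective {S : Type*} [AddCommMonoid S] {s : ℕ} (γ : Fin s → S)
    (τ : MonomialOrder (Fin s)) : Function.Injective (weightKey γ τ) := by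
  rintro ⟨a⟩ ⟨b⟩ h
  have h2 : τ.toSyn a = τ.toSyn b := congrArg (fun p => (ofLex p).2) h
  rw [τ.toSyn.injective h2]

/-- The monomial order `>_{M,τ}`: first compare the weights `M α`, then break ties by `τ`. -/
def weightOrder {S : Type*} [AddCommMonoid S] [LinearOrder S] (hS : IsWellOrderedSemigroup S)
    {s : ℕ} (γ : Fin s → S) (τ : MonomialOrder (Fin s)) : MonomialOrder (Fin s) :=
  letI : LinearOrder (WeightSyn s) := LinearOrder.lift' (weightKey γ τ) (weightKey_injective γ τ)
  have hlt : ∀ a b : WeightSyn s, a < b ↔ monWeight γ a.val < monWeight γ b.val ∨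
      monWeight γ a.val = monWeight γ b.val ∧ τ.toSyn a.val < τ.toSyn b.val := fun a b =>
    Prod.Lex.lt_iff (x := weightKey γ τ a) (y := weightKey γ τ b)
  have hadd : ∀ a b c : WeightSyn s, a < b → c + a < c + b := by
    intro a b c h
    have e : ∀ x : WeightSyn s, (c + x).val = c.val + x.val := fun _ => rfl
    rw [hlt] at h ⊢
    simp only [e, map_add]
    rcases h with h | ⟨h, h'⟩
    · left
      have := hS.add_lt_add _ _ (monWeight γ c.val) h
      rwa [add_comm, add_comm (monWeight γ b.val)] at this
    · right
      exact ⟨by rw [h], by gcongr⟩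
  { syn := WeightSyn s
    isOrderedAddMonoid_syn :=
      { add_le_add_left := fun a b h c => by
          rcases h.eq_or_lt with rfl | h
          · exact le_rfl
          · rw [add_comm a, add_comm b]
            exact (hadd a b c h).le }
    toSyn := { (WeightSyn.equiv s).symm with map_add' := fun _ _ => rfl }
    toSyn_monotone := by
      intro a b h
      obtain ⟨c, rfl⟩ := le_iff_exists_add.mp h
      rcases eq_or_ne c 0 with rfl | hc
      · simp
      · refine ((hlt ⟨a⟩ ⟨a + c⟩).mpr ?_).le
        simp only [map_add]
        rcases (hS.zero_le (monWeight γ c)).eq_or_lt with h0 | h0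
        · right
          refine ⟨by rw [← h0, add_zero], ?_⟩
          have : (0 : τ.syn) < τ.toSyn c :=
            (MonomialOrder.toSyn_lt_iff_ne_zero τ).mpr (by simpa using hc)
          exact lt_add_of_pos_right _ this
        · left
          have := hS.add_lt_add _ _ (monWeight γ a) h0
          rwa [zero_add, add_comm] at this
    wellFoundedLT_syn := by
      have : WellFoundedLT S := ⟨hS.wf⟩
      exact ⟨InvImage.wf (weightKey γ τ) (wellFounded_lt (α := S ×ₗ τ.syn))⟩ }

theorem weightOrder_lt_iff {S : Type*} [AddCommMonoid S] [LinearOrder S]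
    (hS : IsWellOrderedSemigroup S) {s : ℕ} (γ : Fin s → S) (τ : MonomialOrder (Fin s))
    (α β : Fin s →₀ ℕ) :
    (weightOrder hS γ τ).toSyn α < (weightOrder hS γ τ).toSyn β ↔
      monWeight γ α < monWeight γ β ∨
        monWeight γ α = monWeight γ β ∧ τ.toSyn α < τ.toSyn β :=
  Prod.Lex.lt_iff (x := weightKey γ τ ⟨α⟩) (y := weightKey γ τ ⟨β⟩)

/-- The exponents of the standard monomials of `I` (the footprint): those monomials which are not
the leading monomial of a nonzero element of `I`. -/
def standardMonomials {F : Type*} [Field F] {s : ℕ} (m : MonomialOrder (Fin s))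
    (I : Ideal (MvPolynomial (Fin s) F)) : Set (Fin s →₀ ℕ) :=
  {α | ¬ ∃ f ∈ I, f ≠ 0 ∧ m.degree f = α}

/-- `G` is the reduced Gröbner basis of `I` with respect to the monomial order `m`. -/
structure IsReducedGroebnerBasis {F : Type*} [Field F] {s : ℕ} (m : MonomialOrder (Fin s))
    (I : Ideal (MvPolynomial (Fin s) F)) (G : Finset (MvPolynomial (Fin s) F)) : Prop where
  mem : ∀ g ∈ G, g ∈ I
  /-- the leading monomial of every nonzero element of `I` is divisible by one of `G` -/
  exists_degree_le : ∀ f ∈ I, f ≠ 0 → ∃ g ∈ G, m.degree g ≤ m.degree f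
  monic : ∀ g ∈ G, m.leadingCoeff g = 1
  reduced : ∀ g ∈ G, ∀ h ∈ G, h ≠ g → ∀ α ∈ g.support, ¬ m.degree h ≤ α

/-- The Gröbner basis form: for the order `>_{M,τ}`, every element of the reduced Gröbner basis of
`I` has exactly two monomials of highest weight in its support, and the standard monomials of `I`
have distinct weights. -/
def IsGeilPellikaanForm {F : Type*} [Field F] {S : Type*} [AddCommMonoid S] [LinearOrder S]
    (hS : IsWellOrderedSemigroup S) {s : ℕ} (γ : Fin s → S) (τ : MonomialOrder (Fin s))
    (I : Ideal (MvPolynomial (Fin s) F)) : Prop :=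
  (∃ G : Finset (MvPolynomial (Fin s) F),
    IsReducedGroebnerBasis (weightOrder hS γ τ) I G ∧
    ∀ g ∈ G, {α | α ∈ g.support ∧ ∀ β ∈ g.support, monWeight γ β ≤ monWeight γ α}.ncard = 2) ∧
  Set.InjOn (monWeight γ) (standardMonomials (weightOrder hS γ τ) I)

/-- `ρ` is given on `F[X₁, …, X_s] / I` by the maximal weight in the standard form: if `f` is a
linear combination of standard monomials, then `ρ(f) = max {M β : X^β ∈ supp f}`. -/
def IsMaxWeight {F : Type*} [Field F] {S : Type*} [AddCommMonoid S] [LinearOrder S]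
    (hS : IsWellOrderedSemigroup S) {s : ℕ} (γ : Fin s → S) (τ : MonomialOrder (Fin s))
    (I : Ideal (MvPolynomial (Fin s) F)) (ρ : MvPolynomial (Fin s) F ⧸ I → WithBot S) : Prop :=
  ∀ f : MvPolynomial (Fin s) F,
    (∀ α ∈ f.support, α ∈ standardMonomials (weightOrder hS γ τ) I) →
      ρ (Ideal.Quotient.mk I f) = f.support.sup (fun β => (monWeight γ β : WithBot S))

end

/-!
*From `R` to `Γ`.* The leading terms of the nonzero elements of `R` form a cancellative monoid, an
extension of `Γ` by the group of nonzero scalars. A finitely generated cancellative monoid with a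
compatible total order embeds into a free abelian group, so this extension splits: leading
coefficients can be normalised multiplicatively. If `x i` has order `γ i` and normalised leading
coefficient, then `Mα = Mβ` forces `x ^ α - x ^ β` to be a polynomial in `x` of smaller weight. By
Hilbert's basis theorem finitely many of these relations suffice, so only finitely many strict
inequalities between weights matter, and by Gordan's alternative some additive `l : Γ → ℕ`
preserves all of them. The subalgebra of `F[t, t⁻¹] ⊗ R` generated over `F[t]` by the
`t ^ l (γ i) * x i` is torsion-free, hence flat; its generic fibre is `R`, and killing `t` leaves
only the binomials of top weight, so its special fibre is `F[Γ]`.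

*Gröbner bases.* The elements of the reduced Gröbner basis are the `X ^ α - N (X ^ α)`, with `N` the
normal form. Thus `I` is of Geil–Pellikaan form iff the standard monomials have distinct weights and
`N` preserves the weight of every monomial. For the kernel of `F[X] → R` this holds because `ρ`
reads off weights; conversely it makes the weight of the normal form an order function.
-/

open MvPolynomial

open scoped TensorProduct LaurentPolynomial

theorem IsWellOrderedSemigroup.isOrderedCancelAddMonoid {S : Type*} [AddCommMonoid S]
    [LinearOrder S] (hS : IsWellOrderedSemigroup S) : IsOrderedCancelAddMonoid S where
  add_le_add_left a b h c := by
    rcases h.eq_or_lt with rfl | h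
    · exact le_rfl
    · exact (hS.add_lt_add a b c h).le
  le_of_add_le_add_left a b c h := by
    contrapose! h
    simpa only [add_comm a] using hS.add_lt_add c b a h

theorem IsWellOrderedSemigroup.wellFoundedLT {S : Type*} [AddCommMonoid S] [LinearOrder S]
    (hS : IsWellOrderedSemigroup S) : WellFoundedLT S := ⟨hS.wf⟩

section Weight

variable {F : Type*} [CommSemiring F] {S : Type*} [AddCommMonoid S] {s : ℕ} {γ : Fin s → S}

theorem monWeight_single_one (γ : Fin s → S) (i : Fin s) :
    monWeight γ (Finsupp.single i 1) = γ i := by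
  simp [monWeight, Finsupp.weight_single]

theorem monWeight_surjective (hγ : AddSubmonoid.closure (Set.range γ) = ⊤) :
    Function.Surjective (monWeight γ) := by
  rw [← AddMonoidHom.mrange_eq_top, eq_top_iff, ← hγ, AddSubmonoid.closure_le]
  rintro _ ⟨i, rfl⟩
  exact ⟨Finsupp.single i 1, monWeight_single_one γ i⟩

theorem monWeight_comp {T : Type*} [AddCommMonoid T] (l : S →+ T)
    (α : Fin s →₀ ℕ) : monWeight (l ∘ γ) α = l (monWeight γ α) := by
  simp [monWeight, Finsupp.weight_apply, Finsupp.sum, map_sum]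

variable [LinearOrder S] {w : S} {f : MvPolynomial (Fin s) F}

variable (F γ) in
/-- The space of the polynomials all of whose monomials have weight less than `w`. It measures
what may be neglected next to a monomial of weight `w`. -/
noncomputable def weightLT (w : S) : Submodule F (MvPolynomial (Fin s) F) :=
  restrictSupport F {β | monWeight γ β < w}

theorem mem_weightLT : f ∈ weightLT F γ w ↔ ∀ β ∈ f.support, monWeight γ β < w :=
  mem_restrictSupport_iff F

theorem monomial_mem_weightLT {α : Fin s →₀ ℕ} (h : monWeight γ α < w) (c : F) :
    monomial α c ∈ weightLT F γ w :=
  (monomial_mem_restrictSupport F).mpr (.inl h)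

theorem weightLT_mono {v : S} (h : v ≤ w) : weightLT F γ v ≤ weightLT F γ w :=
  restrictSupport_mono F fun _ hβ => lt_of_lt_of_le hβ h

theorem weightLT_le_iff {M : Submodule F (MvPolynomial (Fin s) F)} :
    weightLT F γ w ≤ M ↔ ∀ β, monWeight γ β < w → monomial β 1 ∈ M := by
  rw [weightLT, restrictSupport_eq_span, Submodule.span_le, Set.image_subset_iff]
  rfl

theorem monomial_mul_mem_weightLT [IsOrderedCancelAddMonoid S] (α : Fin s →₀ ℕ) (c : F)
    (hf : f ∈ weightLT F γ w) : monomial α c * f ∈ weightLT F γ (monWeight γ α + w) := by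
  suffices weightLT F γ w ≤ (weightLT F γ (monWeight γ α + w)).comap
    (LinearMap.mulLeft F (monomial α c)) from this hf
  refine weightLT_le_iff.mpr fun β hβ => ?_
  rw [Submodule.mem_comap, LinearMap.mulLeft_apply, monomial_mul]
  exact monomial_mem_weightLT (by rw [map_add]; gcongr) _

end Weight

namespace IsOrderFunction

variable {F : Type*} [Field F] {R : Type*} [CommRing R] [Algebra F R]
  {S : Type*} [AddCommMonoid S] [LinearOrder S] {ρ : R → WithBot S}

theorem map_zero (h : IsOrderFunction F ρ) : ρ 0 = ⊥ := (h.eq_bot_iff 0).mpr rfl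

theorem exists_eq_coe (h : IsOrderFunction F ρ) {f : R} (hf : f ≠ 0) : ∃ w : S, ρ f = w :=
  (WithBot.ne_bot_iff_exists.mp (mt (h.eq_bot_iff f).mp hf)).imp fun _ => Eq.symm

theorem ne_zero_of_eq_coe (h : IsOrderFunction F ρ) {f : R} {w : S} (hf : ρ f = w) : f ≠ 0 :=
  fun hf0 => WithBot.bot_ne_coe (h.map_zero.symm.trans (hf0 ▸ hf))

theorem isDomain (h : IsOrderFunction F ρ) : IsDomain R := by
  have : Nontrivial R := by
    obtain ⟨f, hf⟩ := h.surjective (0 : S)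
    exact nontrivial_of_ne f 0 (h.ne_zero_of_eq_coe hf)
  have : NoZeroDivisors R := ⟨fun {f g} hfg => by
    rwa [← h.eq_bot_iff, h.mul, WithBot.add_eq_bot, h.eq_bot_iff, h.eq_bot_iff] at hfg⟩
  exact NoZeroDivisors.to_isDomain R

/-- The space of the elements of order less than `w`, the open ball of the filtration of `R`
defined by `ρ`. -/
def ltSubmodule (h : IsOrderFunction F ρ) (w : S) : Submodule F R where
  carrier := {f | ρ f < w}
  zero_mem' := by simp [h.map_zero]
  add_mem' {a b} ha hb := (h.add_le a b).trans_lt (max_lt ha hb)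
  smul_mem' c f hf := by
    rcases eq_or_ne c 0 with rfl | hc
    · simp [h.map_zero]
    · simpa [h.smul c f hc] using hf

theorem mem_ltSubmodule (h : IsOrderFunction F ρ) {w : S} {f : R} :
    f ∈ h.ltSubmodule w ↔ ρ f < w := Iff.rfl

theorem linearIndependent (h : IsOrderFunction F ρ) {y : S → R} (hy : ∀ w, ρ (y w) = w) :
    LinearIndependent F y := by
  classical
  rw [linearIndependent_iff']
  intro t a hsum
  by_contra! hne
  obtain ⟨w, hw, hmax⟩ := (t.filter fun w => a w ≠ 0).exists_max_image id
    (hne.imp fun _ hw => Finset.mem_filter.mpr hw)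
  obtain ⟨hwt, hw0⟩ := Finset.mem_filter.mp hw
  have hlt : -∑ v ∈ t.erase w, a v • y v ∈ h.ltSubmodule w := by
    refine neg_mem (sum_mem fun v hv => ?_)
    obtain ⟨hvw, hvt⟩ := Finset.mem_erase.mp hv
    by_cases hv0 : a v = 0
    · rw [hv0, zero_smul]
      exact zero_mem _
    · refine Submodule.smul_mem _ _ (h.mem_ltSubmodule.mpr ?_)
      rw [hy, WithBot.coe_lt_coe]
      exact (hmax v (Finset.mem_filter.mpr ⟨hvt, hv0⟩)).lt_of_ne hvw
  rw [← Finset.add_sum_erase _ _ hwt, add_eq_zero_iff_eq_neg] at hsum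
  rw [← hsum, h.mem_ltSubmodule, h.smul _ _ hw0, hy] at hlt
  exact hlt.false

theorem map_sub_comm (h : IsOrderFunction F ρ) (f g : R) : ρ (f - g) = ρ (g - f) := by
  rw [← neg_sub, ← neg_one_smul F (g - f), h.smul _ _ (neg_ne_zero.mpr one_ne_zero)]

theorem map_one [IsOrderedCancelAddMonoid S] (h : IsOrderFunction F ρ) : ρ 1 = 0 := by
  have := h.isDomain
  obtain ⟨a, ha⟩ := h.exists_eq_coe one_ne_zero
  have hmul := h.mul 1 1
  rw [mul_one, ha, ← WithBot.coe_add, WithBot.coe_inj, left_eq_add] at hmul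
  rw [ha, hmul, WithBot.coe_zero]

theorem map_pow [IsOrderedCancelAddMonoid S] (h : IsOrderFunction F ρ) {f : R} {a : S}
    (hf : ρ f = a) (n : ℕ) : ρ (f ^ n) = (n • a : S) := by
  induction n with
  | zero => simp [h.map_one]
  | succ n ih => rw [pow_succ, h.mul, ih, hf, succ_nsmul, WithBot.coe_add]

variable {s : ℕ} {γ : Fin s → S} {x : Fin s → R}

theorem map_aeval_monomial [IsOrderedCancelAddMonoid S] (h : IsOrderFunction F ρ)
    (hx : ∀ i, ρ (x i) = γ i) (α : Fin s →₀ ℕ) :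
    ρ (aeval x (monomial α (1 : F))) = monWeight γ α := by
  induction α using Finsupp.induction_linear with
  | zero => simp [h.map_one]
  | add a b ha hb =>
    rw [← one_mul (1 : F), ← monomial_mul, _root_.map_mul, h.mul, ha, hb, map_add,
      WithBot.coe_add]
  | single i n =>
    rw [← X_pow_eq_monomial, _root_.map_pow, aeval_X, h.map_pow (hx i)]
    simp [monWeight, Finsupp.weight_single]

theorem aeval_mem_ltSubmodule [IsOrderedCancelAddMonoid S] (h : IsOrderFunction F ρ)
    (hx : ∀ i, ρ (x i) = γ i) {w : S} {f : MvPolynomial (Fin s) F} (hf : f ∈ weightLT F γ w) :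
    aeval x f ∈ h.ltSubmodule w := by
  suffices weightLT F γ w ≤ (h.ltSubmodule w).comap (aeval x).toLinearMap from this hf
  refine weightLT_le_iff.mpr fun β hβ => ?_
  rw [Submodule.mem_comap, AlgHom.toLinearMap_apply, mem_ltSubmodule, h.map_aeval_monomial hx]
  exact WithBot.coe_lt_coe.mpr hβ

theorem exists_sub_smul_aeval_mem_ltSubmodule [IsOrderedCancelAddMonoid S]
    (h : IsOrderFunction F ρ) (hγ : AddSubmonoid.closure (Set.range γ) = ⊤)
    (hx : ∀ i, ρ (x i) = γ i) {r : R} (hr : r ≠ 0) :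
    ∃ α : Fin s →₀ ℕ, ρ r = monWeight γ α ∧ ∃ c : F,
      r - c • aeval x (monomial α (1 : F)) ∈ h.ltSubmodule (monWeight γ α) := by
  obtain ⟨v, hv⟩ := h.exists_eq_coe hr
  obtain ⟨α, rfl⟩ := monWeight_surjective hγ v
  obtain ⟨c, -, hc⟩ := h.exists_sub_lt r (aeval x (monomial α (1 : F)))
    (by rw [hv, h.map_aeval_monomial hx]) (by simp [hv])
  exact ⟨α, hv, c, hc.trans_eq hv⟩

theorem exists_mem_weightLT_aeval_eq [IsOrderedCancelAddMonoid S] [WellFoundedLT S]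
    (h : IsOrderFunction F ρ) (hγ : AddSubmonoid.closure (Set.range γ) = ⊤)
    (hx : ∀ i, ρ (x i) = γ i) {w : S} {r : R} (hr : r ∈ h.ltSubmodule w) :
    ∃ f ∈ weightLT F γ w, aeval x f = r := by
  induction w using WellFoundedLT.induction generalizing r with
  | _ w ih =>
  rcases eq_or_ne r 0 with rfl | hr0
  · exact ⟨0, zero_mem _, _root_.map_zero _⟩
  obtain ⟨α, hα, c, hc⟩ := h.exists_sub_smul_aeval_mem_ltSubmodule hγ hx hr0
  have hαw : monWeight γ α < w := WithBot.coe_lt_coe.mp (hα ▸ hr)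
  obtain ⟨f, hf, hfr⟩ := ih _ hαw hc
  refine ⟨f + c • monomial α 1, add_mem (weightLT_mono hαw.le hf)
    (Submodule.smul_mem _ c (monomial_mem_weightLT hαw 1)), ?_⟩
  rw [map_add, hfr, map_smul, sub_add_cancel]

theorem aeval_surjective [IsOrderedCancelAddMonoid S] [WellFoundedLT S]
    (h : IsOrderFunction F ρ) (hγ : AddSubmonoid.closure (Set.range γ) = ⊤)
    (hx : ∀ i, ρ (x i) = γ i) : Function.Surjective (aeval (R := F) x) := by
  intro r
  rcases eq_or_ne r 0 with rfl | hr0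
  · exact ⟨0, _root_.map_zero _⟩
  obtain ⟨α, -, c, hc⟩ := h.exists_sub_smul_aeval_mem_ltSubmodule hγ hx hr0
  obtain ⟨f, -, hfr⟩ := h.exists_mem_weightLT_aeval_eq hγ hx hc
  exact ⟨f + c • monomial α 1, by rw [map_add, hfr, map_smul, sub_add_cancel]⟩

end IsOrderFunction

section LeadingCoefficient

open Algebra
open scoped nonZeroDivisors

theorem exists_eq_of_sub_of {M : Type*} [AddCommMonoid M] (e : GrothendieckAddGroup M) :
    ∃ a b : M, e = GrothendieckAddGroup.of a - GrothendieckAddGroup.of b := by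
  obtain ⟨⟨a, b⟩, hab⟩ := (AddLocalization.addMonoidOf (⊤ : AddSubmonoid M)).surj e
  exact ⟨a, b, eq_sub_of_add_eq hab⟩

theorem exists_retraction_of_projective {A Q S : Type*} [AddCommGroup A] [AddCommMonoid Q]
    [IsCancelAdd Q] [AddCommMonoid S] [IsCancelAdd S]
    [Module.Projective ℤ (GrothendieckAddGroup S)] {i : A →+ Q} (hi : Function.Injective i)
    {ν : Q →+ S} (hν : Function.Surjective ν) (hfib : ∀ a b, ν a = ν b ↔ ∃ c, a = i c + b) :
    ∃ χ : Q →+ A, χ.comp i = AddMonoidHom.id A := by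
  let f : A →ₗ[ℤ] GrothendieckAddGroup Q := (GrothendieckAddGroup.of.comp i).toIntLinearMap
  let g : GrothendieckAddGroup Q →ₗ[ℤ] GrothendieckAddGroup S :=
    (GrothendieckAddGroup.lift (GrothendieckAddGroup.of.comp ν)).toIntLinearMap
  have hg (q : Q) : g (GrothendieckAddGroup.of q) = GrothendieckAddGroup.of (ν q) :=
    DFunLike.congr_fun (GrothendieckAddGroup.lift.symm_apply_apply _) q
  have hexact : Function.Exact f g := fun e => by
    obtain ⟨a, b, rfl⟩ := exists_eq_of_sub_of e
    rw [map_sub, hg, hg, sub_eq_zero, GrothendieckAddGroup.of_injective.eq_iff, hfib]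
    refine exists_congr fun c => ?_
    rw [eq_sub_iff_add_eq, ← GrothendieckAddGroup.of_injective.eq_iff, map_add, eq_comm]
    rfl
  have hsurj : Function.Surjective g := fun e => by
    obtain ⟨v, w, rfl⟩ := exists_eq_of_sub_of e
    obtain ⟨⟨a, rfl⟩, b, rfl⟩ := And.intro (hν v) (hν w)
    exact ⟨GrothendieckAddGroup.of a - GrothendieckAddGroup.of b, by rw [map_sub, hg, hg]⟩
  have hsection := Module.projective_lifting_property g LinearMap.id hsurj
  have hf : Function.Injective f := GrothendieckAddGroup.of_injective.comp hi
  obtain ⟨χ, hχ⟩ := ((hexact.split_tfae hf hsurj).out 0 1).mp hsection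
  exact ⟨χ.toAddMonoidHom.comp GrothendieckAddGroup.of, DFunLike.ext _ _ (LinearMap.congr_fun hχ)⟩

namespace IsOrderFunction

variable {F : Type*} [Field F] {R : Type*} [CommRing R] [Algebra F R]
  {S : Type*} [AddCommMonoid S] [LinearOrder S] {ρ : R → WithBot S}

theorem map_eq_of_sub_lt (h : IsOrderFunction F ρ) {f g : R} (hfg : ρ (f - g) < ρ f) :
    ρ g = ρ f := by
  have hgf := h.add_le g (f - g)
  have hfg' := h.add_le f (g - f)
  rw [add_sub_cancel] at hgf hfg'
  rw [h.map_sub_comm g f, max_eq_left hfg.le] at hfg'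
  exact hfg'.antisymm ((le_max_iff.mp hgf).resolve_right hfg.not_ge)

theorem mul_lt_mul_left_iff [IsOrderedCancelAddMonoid S] (h : IsOrderFunction F ρ) {a f g : R}
    (ha : a ≠ 0) : ρ (a * f) < ρ (a * g) ↔ ρ f < ρ g := by
  obtain ⟨w, hw⟩ := h.exists_eq_coe ha
  rw [h.mul, h.mul, hw, WithBot.add_lt_add_iff_left WithBot.coe_ne_bot]

/-- Two nonzero elements are identified if they have the same leading term with respect to `ρ`.
The quotient is the monoid of the nonzero homogeneous elements of the associated graded ring. -/
def leadingTermCon [IsOrderedCancelAddMonoid S] (h : IsOrderFunction F ρ) : Con R⁰ where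
  r f g := ρ (f - g : R) < ρ f
  iseqv :=
    { refl f := by
        have := h.isDomain
        rw [sub_self, h.map_zero, bot_lt_iff_ne_bot, Ne, h.eq_bot_iff]
        exact nonZeroDivisors.coe_ne_zero f
      symm {f g} hfg := by rwa [h.map_eq_of_sub_lt hfg, h.map_sub_comm]
      trans {f g k} hfg hgk := by
        rw [← sub_add_sub_cancel (f : R) g]
        exact (h.add_le _ _).trans_lt (max_lt hfg (h.map_eq_of_sub_lt hfg ▸ hgk)) }
  mul' {f g f' g'} hf hg := by
    have := h.isDomain
    have hsplit : (f * f' - g * g' : R) = f' * (f - g) + g * (f' - g') := by ring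
    rw [Submonoid.coe_mul, Submonoid.coe_mul, hsplit]
    refine (h.add_le _ _).trans_lt (max_lt ?_ ?_)
    · rwa [mul_comm (f : R), h.mul_lt_mul_left_iff (nonZeroDivisors.coe_ne_zero _)]
    · rwa [h.mul f, ← h.map_eq_of_sub_lt hf, ← h.mul,
        h.mul_lt_mul_left_iff (nonZeroDivisors.coe_ne_zero _)]

theorem map_algebraMap [IsOrderedCancelAddMonoid S] (h : IsOrderFunction F ρ) {c : F}
    (hc : c ≠ 0) : ρ (algebraMap F R c) = 0 := by
  rw [Algebra.algebraMap_eq_smul_one, h.smul _ _ hc, h.map_one]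

theorem exists_sub_algebraMap_mul_lt (h : IsOrderFunction F ρ) {f g : R} (hf : f ≠ 0)
    (hfg : ρ f = ρ g) : ∃ c : Fˣ, ρ (f - algebraMap F R c * g) < ρ f := by
  obtain ⟨c, hc, hlt⟩ := h.exists_sub_lt f g hfg (mt (h.eq_bot_iff f).mp hf)
  exact ⟨Units.mk0 c hc, by rwa [Units.val_mk0, ← Algebra.smul_def]⟩

variable [IsOrderedCancelAddMonoid S]

/-- The leading term of a nonzero element. The monoid of the leading terms is written additively, to
match the value semigroup. -/
def leadingTerm (h : IsOrderFunction F ρ) (f : R⁰) : Additive h.leadingTermCon.Quotient :=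
  .ofMul (h.leadingTermCon.mk' f)

theorem leadingTerm_surjective (h : IsOrderFunction F ρ) : Function.Surjective h.leadingTerm :=
  h.leadingTermCon.mk'_surjective

theorem leadingTerm_eq_iff (h : IsOrderFunction F ρ) {f g : R⁰} :
    h.leadingTerm f = h.leadingTerm g ↔ ρ (f - g : R) < ρ f :=
  h.leadingTermCon.eq

instance (h : IsOrderFunction F ρ) : IsCancelAdd (Additive h.leadingTermCon.Quotient) :=
  have : IsLeftCancelAdd (Additive h.leadingTermCon.Quotient) := ⟨fun a b c habc => by
    have := h.isDomain
    obtain ⟨a, rfl⟩ := h.leadingTerm_surjective a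
    obtain ⟨f, rfl⟩ := h.leadingTerm_surjective b
    obtain ⟨g, rfl⟩ := h.leadingTerm_surjective c
    have hlt : ρ (a * f - a * g : R) < ρ (a * f) := h.leadingTerm_eq_iff.mp habc
    rw [← mul_sub, h.mul_lt_mul_left_iff (nonZeroDivisors.coe_ne_zero a)] at hlt
    exact h.leadingTerm_eq_iff.mpr hlt⟩
  AddCommMagma.IsLeftCancelAdd.toIsCancelAdd _

/-- The order of a leading term. -/
noncomputable def leadingTermOrder (h : IsOrderFunction F ρ) :
    Additive h.leadingTermCon.Quotient →+ S :=
  have := h.isDomain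
  have hne (f : R⁰) : ρ f ≠ ⊥ := mt (h.eq_bot_iff f).mp (nonZeroDivisors.coe_ne_zero f)
  { toFun q := (q.toMul : h.leadingTermCon.Quotient).liftOn (fun f => (ρ f).unbot (hne f))
      fun f g hfg => by simp only [h.map_eq_of_sub_lt hfg]
    map_zero' := (WithBot.unbot_eq_iff (hne 1)).mpr h.map_one
    map_add' := by
      rintro ⟨f⟩ ⟨g⟩
      refine (WithBot.unbot_eq_iff (hne (f * g))).mpr ?_
      exact (h.mul f g).trans
        (congrArg₂ _ (WithBot.coe_unbot _ (hne f)).symm (WithBot.coe_unbot _ (hne g)).symm) }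

theorem coe_leadingTermOrder_leadingTerm (h : IsOrderFunction F ρ) (f : R⁰) :
    (h.leadingTermOrder (h.leadingTerm f) : WithBot S) = ρ f :=
  WithBot.coe_unbot _ _

theorem leadingTermOrder_surjective (h : IsOrderFunction F ρ) :
    Function.Surjective h.leadingTermOrder := fun w => by
  have := h.isDomain
  obtain ⟨f, hf⟩ := h.surjective w
  let f' : R⁰ := ⟨f, mem_nonZeroDivisors_of_ne_zero (h.ne_zero_of_eq_coe hf)⟩
  exact ⟨_, WithBot.coe_injective ((h.coe_leadingTermOrder_leadingTerm f').trans hf)⟩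

/-- The nonzero constants, as leading terms. -/
def constLeadingTerm (h : IsOrderFunction F ρ) :
    Additive Fˣ →+ Additive h.leadingTermCon.Quotient :=
  have := h.isDomain
  (h.leadingTermCon.mk'.comp
    { toFun (c : Fˣ) := ⟨algebraMap F R c, (c.isUnit.map _).mem_nonZeroDivisors⟩
      map_one' := Subtype.ext (_root_.map_one _)
      map_mul' _ _ := Subtype.ext (_root_.map_mul _ _ _) }).toAdditive

theorem constLeadingTerm_injective (h : IsOrderFunction F ρ) :
    Function.Injective h.constLeadingTerm := fun (c d : Fˣ) hcd => by
  have hlt : ρ (algebraMap F R c - algebraMap F R d) < ρ (algebraMap F R c) :=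
    h.leadingTerm_eq_iff.mp hcd
  by_contra hne
  rw [← map_sub, h.map_algebraMap c.ne_zero,
    h.map_algebraMap (sub_ne_zero.mpr (Units.val_injective.ne hne))] at hlt
  exact lt_irrefl _ hlt

theorem leadingTermOrder_eq_iff (h : IsOrderFunction F ρ)
    (a b : Additive h.leadingTermCon.Quotient) :
    h.leadingTermOrder a = h.leadingTermOrder b ↔ ∃ c, a = h.constLeadingTerm c + b := by
  have := h.isDomain
  obtain ⟨f, rfl⟩ := h.leadingTerm_surjective a
  obtain ⟨g, rfl⟩ := h.leadingTerm_surjective b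
  constructor
  · intro hfg
    rw [← WithBot.coe_inj, h.coe_leadingTermOrder_leadingTerm,
      h.coe_leadingTermOrder_leadingTerm] at hfg
    obtain ⟨c, hc⟩ := h.exists_sub_algebraMap_mul_lt (nonZeroDivisors.coe_ne_zero f) hfg
    exact ⟨.ofMul c, h.leadingTerm_eq_iff.mpr hc⟩
  · rintro ⟨c, hc⟩
    rw [hc, map_add, add_eq_right, ← WithBot.coe_inj, WithBot.coe_zero,
      ← h.map_algebraMap c.toMul.ne_zero]
    exact h.coe_leadingTermOrder_leadingTerm _

theorem exists_submonoid_monic [Module.Projective ℤ (GrothendieckAddGroup S)]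
    (h : IsOrderFunction F ρ) :
    ∃ N : Submonoid R, (∀ w : S, ∃ f ∈ N, ρ f = w) ∧
      ∀ f ∈ N, ∀ g ∈ N, ρ f = ρ g → ρ (f - g) < ρ f := by
  obtain ⟨χ, hχ⟩ := exists_retraction_of_projective h.constLeadingTerm_injective
    h.leadingTermOrder_surjective h.leadingTermOrder_eq_iff
  replace hχ : ∀ c, χ (h.constLeadingTerm c) = c := DFunLike.congr_fun hχ
  let N : Submonoid R⁰ := MonoidHom.mker (χ.toMultiplicative.comp h.leadingTermCon.mk')
  have hN (f : R⁰) : f ∈ N ↔ χ (h.leadingTerm f) = 0 := Iff.rfl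
  refine ⟨N.map R⁰.subtype, fun w => ?_, ?_⟩
  · obtain ⟨a, rfl⟩ := h.leadingTermOrder_surjective w
    obtain ⟨f, hf⟩ := h.leadingTerm_surjective (h.constLeadingTerm (-χ a) + a)
    refine ⟨f, ⟨f, (hN f).mpr (by rw [hf, map_add, hχ, neg_add_cancel]), rfl⟩, ?_⟩
    rw [← h.coe_leadingTermOrder_leadingTerm, WithBot.coe_inj, h.leadingTermOrder_eq_iff]
    exact ⟨_, hf⟩
  · rintro _ ⟨f, hf, rfl⟩ _ ⟨g, hg, rfl⟩ hfg
    obtain ⟨c, hc⟩ := (h.leadingTermOrder_eq_iff (h.leadingTerm f) (h.leadingTerm g)).mp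
      (WithBot.coe_injective (by simpa only [coe_leadingTermOrder_leadingTerm] using! hfg))
    have hc0 : c = 0 := by
      simpa only [map_add, hχ, (hN f).mp hf, (hN g).mp hg, add_zero, eq_comm] using congrArg χ hc
    rw [hc0, _root_.map_zero, zero_add] at hc
    exact h.leadingTerm_eq_iff.mp hc

end IsOrderFunction
end LeadingCoefficient

section Gordan

open Algebra

theorem exists_addMonoidHom_int_pos {G : Type*} [AddCommGroup G] [AddGroup.FG G] {a : G}
    (ha : ∀ n : ℕ, 0 < n → n • a ≠ 0) : ∃ k : G →+ ℤ, 0 < k a := by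
  have : Module.Finite ℤ G := Module.Finite.iff_addGroup_fg.mpr ‹_›
  let π := (Submodule.torsion ℤ G).mkQ
  have hπ : π a ≠ 0 := fun h => by
    obtain ⟨n, hn⟩ := (Submodule.Quotient.mk_eq_zero _).mp h
    refine ha (n : ℤ).natAbs (Int.natAbs_pos.mpr (nonZeroDivisors.coe_ne_zero n)) ?_
    rcases Int.natAbs_eq n with h | h <;> rw [Submonoid.smul_def, h] at hn <;> simpa using hn
  obtain ⟨k, hk⟩ := not_forall.mp (mt (Module.forall_dual_apply_eq_zero_iff ℤ (π a)).mp hπ)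
  rcases lt_or_gt_of_ne hk with hk | hk
  · exact ⟨(-k ∘ₗ π).toAddMonoidHom, by simpa using hk⟩
  · exact ⟨(k ∘ₗ π).toAddMonoidHom, hk⟩

theorem exists_nat_forall_pos_add_mul {ι : Type*} {t : Set ι} (ht : t.Finite)
    (k g : ι → ℤ) (hg : ∀ i ∈ t, 0 < g i) : ∃ N : ℕ, ∀ i ∈ t, 0 < k i + N * g i := by
  obtain ⟨N, hN⟩ := (ht.image fun i => (k i).natAbs + 1).bddAbove
  refine ⟨N, fun i hi => ?_⟩
  have hNi : (k i).natAbs + 1 ≤ N := hN ⟨i, hi, rfl⟩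
  nlinarith [hg i hi, neg_abs_le (k i), Int.natCast_natAbs (k i)]

theorem pos_of_mem_addSubsemigroup_closure {G A : Type*} [AddMonoid G] [AddMonoid A] [Preorder A]
    [AddLeftMono A] {T : Set G} {f : G →+ A} (hf : ∀ v ∈ T, 0 < f v) {x : G}
    (hx : x ∈ AddSubsemigroup.closure T) : 0 < f x := by
  induction hx using AddSubsemigroup.closure_induction with
  | mem v hv => exact hf v hv
  | add y z _ _ hy hz => rw [map_add]; exact add_pos_of_pos_of_nonneg hy hz.le

theorem nsmul_mem_addSubsemigroup_closure {G : Type*} [AddMonoid G] {T : Set G} {a : G}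
    (ha : a ∈ T) {n : ℕ} (hn : 0 < n) : n • a ∈ AddSubsemigroup.closure T := by
  induction n, hn using Nat.le_induction with
  | base => simpa using AddSubsemigroup.subset_closure ha
  | succ n _ ih => rw [succ_nsmul]; exact add_mem ih (AddSubsemigroup.subset_closure ha)

theorem addSubsemigroup_closure_image {G H : Type*} [AddMonoid G] [AddMonoid H] (π : G →+ H)
    (T : Set G) :
    AddSubsemigroup.closure (π '' T) = (AddSubsemigroup.closure T).map (π : AddHom G H) :=
  (AddHom.map_mclosure (π : AddHom G H) T).symm

/- Induct on `t`. If `0` is still not a positive combination modulo the new vector, lift a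
functional from the quotient, scaled up so as to dominate one that is positive on the new vector.
Otherwise a positive multiple of the new vector is a positive combination of the old ones. -/
theorem exists_addMonoidHom_int_forall_pos {ι : Type*} {t : Set ι} (ht : t.Finite) :
    ∀ (G : Type*) [AddCommGroup G] [AddGroup.FG G] (v : ι → G),
      0 ∉ AddSubsemigroup.closure (v '' t) → ∃ f : G →+ ℤ, ∀ i ∈ t, 0 < f (v i) := by
  induction t, ht using Set.Finite.induction_on with
  | empty => exact fun G _ _ v _ => ⟨0, by simp⟩
  | @insert a t _ ht ih =>
    intro G _ _ v h0
    rw [Set.image_insert_eq] at h0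
    have hle : AddSubsemigroup.closure (v '' t) ≤
        AddSubsemigroup.closure (insert (v a) (v '' t)) :=
      AddSubsemigroup.closure_mono (Set.subset_insert _ _)
    have ha (n : ℕ) (hn : 0 < n) : n • v a ∈ AddSubsemigroup.closure (insert (v a) (v '' t)) :=
      nsmul_mem_addSubsemigroup_closure (Set.mem_insert _ _) hn
    let π : G →+ G ⧸ AddSubgroup.zmultiples (v a) := QuotientAddGroup.mk' _
    by_cases hq : 0 ∈ AddSubsemigroup.closure ((π ∘ v) '' t)
    · obtain ⟨f, hf⟩ := ih G v (mt (@hle 0) h0)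
      obtain ⟨x, hx, b, hb⟩ : ∃ x ∈ AddSubsemigroup.closure (v '' t), ∃ b : ℤ, b • v a = x := by
        rw [Set.image_comp, addSubsemigroup_closure_image] at hq
        obtain ⟨x, hx, hx0⟩ := hq
        exact ⟨x, hx, (QuotientAddGroup.eq_zero_iff x).mp hx0⟩
      have hfx : 0 < b * f (v a) := by
        simpa [← hb] using pos_of_mem_addSubsemigroup_closure (Set.forall_mem_image.mpr hf) hx
      have hb0 : 0 < b := by
        by_contra! hb0
        obtain ⟨n, rfl⟩ := Int.exists_eq_neg_ofNat hb0
        rcases n.eq_zero_or_pos with rfl | hn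
        · exact h0 (hle (by simpa [← hb] using hx))
        · exact h0 (by simpa [← hb] using add_mem (hle hx) (ha n hn))
      exact ⟨f, Set.forall_mem_insert.mpr ⟨(mul_pos_iff_of_pos_left hb0).mp hfx, hf⟩⟩
    · obtain ⟨g, hg⟩ := ih _ (π ∘ v) hq
      obtain ⟨k, hk⟩ := exists_addMonoidHom_int_pos fun n hn h => h0 (h ▸ ha n hn)
      obtain ⟨N, hN⟩ := exists_nat_forall_pos_add_mul ht (k ∘ v) (g ∘ π ∘ v) hg
      refine ⟨k + N • g.comp π, Set.forall_mem_insert.mpr ⟨?_, fun i hi => by simpa using hN i hi⟩⟩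
      have : π (v a) = 0 := (QuotientAddGroup.eq_zero_iff _).mpr (AddSubgroup.mem_zmultiples _)
      simpa [this] using hk

theorem exists_addMonoidHom_nat_forall_lt {S : Type*} [AddCommMonoid S] [LinearOrder S]
    [IsOrderedCancelAddMonoid S] [AddMonoid.FG S] (h0 : ∀ a : S, 0 ≤ a) {T : Set (S × S)}
    (hT : T.Finite) (hlt : ∀ p ∈ T, p.1 < p.2) : ∃ l : S →+ ℕ, ∀ p ∈ T, l p.1 < l p.2 := by
  let ι := GrothendieckAddGroup.of (M := S)
  obtain ⟨B, hB⟩ := AddMonoid.FG.fg_top (M := S)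
  let U : Set (S × S) := T ∪ (fun b => (0, b)) '' {b ∈ (B : Set S) | 0 < b}
  have hU : U.Finite := hT.union ((B.finite_toSet.subset (Set.sep_subset _ _)).image _)
  have hUlt : ∀ p ∈ U, p.1 < p.2 := by
    rintro p (hp | ⟨b, hb, rfl⟩)
    exacts [hlt p hp, hb.2]
  have : AddGroup.FG (GrothendieckAddGroup S) := Module.Finite.iff_addGroup_fg.mp inferInstance
  obtain ⟨f, hf⟩ := exists_addMonoidHom_int_forall_pos hU (GrothendieckAddGroup S)
    (fun p => ι p.2 - ι p.1) fun h => (pos_of_mem_addSubsemigroup_closure (f := .id _)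
      (Set.forall_mem_image.mpr fun p hp => sub_pos.mpr
        ((AddLocalization.mkOrderEmbedding 0).lt_iff_lt.mpr (hUlt p hp))) h).ne rfl
  have hf0 (a : S) : 0 ≤ f (ι a) := by
    have ha : a ∈ AddSubmonoid.closure (B : Set S) := hB ▸ AddSubmonoid.mem_top a
    induction ha using AddSubmonoid.closure_induction with
    | mem b hb =>
      rcases (h0 b).eq_or_lt with rfl | hb0
      · simp
      · simpa using (hf _ (Or.inr ⟨b, ⟨hb, hb0⟩, rfl⟩)).le
    | zero => simp
    | add a b _ _ ha hb => simpa using add_nonneg ha hb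
  refine ⟨⟨⟨fun a => (f (ι a)).toNat, by simp⟩, fun a b => ?_⟩, fun p hp => ?_⟩
  · simp [Int.toNat_add, hf0]
  · have h : f (ι p.1) < f (ι p.2) := by simpa using hf p (Or.inl hp)
    exact (Int.toNat_lt_toNat ((hf0 _).trans_lt h)).mpr h

end Gordan

section InitialForms

/- Hilbert's basis theorem, applied to the ideal which the congruence generates in the monoid
algebra. -/
theorem exists_finite_forall_le_addCon {M : Type*} [AddCommMonoid M] [AddMonoid.FG M]
    (c : AddCon M) : ∃ T : Set (M × M), T.Finite ∧ (∀ p ∈ T, c p.1 p.2) ∧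
      ∀ d : AddCon M, (∀ p ∈ T, d p.1 p.2) → c ≤ d := by
  have : IsNoetherianRing (AddMonoidAlgebra ℤ M) := Algebra.FiniteType.isNoetherianRing ℤ _
  let δ : M × M → AddMonoidAlgebra ℤ M := fun p => .single p.1 1 - .single p.2 1
  obtain ⟨B, hBC, hB⟩ := (Submodule.fg_span_iff_fg_span_finset_subset (δ '' {p | c p.1 p.2})).mp
    ((isNoetherianRing_iff_ideal_fg _).mp this _)
  obtain ⟨T, hTC, hT, hTB⟩ := B.finite_toSet.exists_subset_finite_image_eq hBC
  refine ⟨T, hT, hTC, fun d hd a b hab => ?_⟩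
  let π := AddMonoidAlgebra.mapDomainRingHom ℤ d.mk'
  have hπ (p : M × M) : δ p ∈ RingHom.ker π ↔ d p.1 p.2 := by
    rw [RingHom.mem_ker, map_sub, sub_eq_zero]
    simp [π, AddMonoidAlgebra.single_left_inj]
  have hspan : Ideal.span (δ '' {p | c p.1 p.2}) ≤ RingHom.ker π := by
    rw [Ideal.span, hB, ← hTB]
    exact Ideal.span_le.mpr (Set.image_subset_iff.mpr fun p hp => (hπ p).mpr (hd p hp))
  exact (hπ (a, b)).mp (hspan (Ideal.subset_span ⟨(a, b), hab, rfl⟩))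

variable {F : Type*} [CommRing F] {R : Type*} [CommRing R] [Algebra F R]
  {S : Type*} [AddCommMonoid S] [LinearOrder S] [IsOrderedCancelAddMonoid S] {s : ℕ}

variable (F) in
/-- The exponents `α` and `β` of the same `n`-weight are congruent if `x^α - x^β` is a polynomial in
the `x i` of smaller `n`-weight. -/
def initialCon (x : Fin s → R) (n : Fin s → S) : AddCon (Fin s →₀ ℕ) where
  r α β := monWeight n α = monWeight n β ∧ ∃ f ∈ weightLT F n (monWeight n α),
    aeval x f = aeval x (monomial α (1 : F)) - aeval x (monomial β (1 : F))
  iseqv :=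
    { refl := fun α => ⟨rfl, 0, zero_mem _, by simp⟩
      symm := fun ⟨h, f, hf, hfx⟩ => ⟨h.symm, -f, neg_mem (h ▸ hf), by rw [map_neg, hfx, neg_sub]⟩
      trans := fun ⟨h, f, hf, hfx⟩ ⟨h', g, hg, hgx⟩ =>
        ⟨h.trans h', f + g, add_mem hf (h ▸ hg), by rw [map_add, hfx, hgx, sub_add_sub_cancel]⟩ }
  add' := by
    rintro α β α' β' ⟨h, f, hf, hfx⟩ ⟨h', g, hg, hgx⟩
    refine ⟨by rw [map_add, map_add, h, h'], monomial α 1 * g + monomial β' 1 * f,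
      add_mem ?_ ?_, ?_⟩
    · rw [map_add]
      exact monomial_mul_mem_weightLT α 1 hg
    · rw [map_add, h', add_comm]
      exact monomial_mul_mem_weightLT β' 1 hf
    · have hmul (δ ε : Fin s →₀ ℕ) : monomial (δ + ε) (1 : F) = monomial δ 1 * monomial ε 1 := by
        rw [monomial_mul, one_mul]
      rw [hmul, hmul, map_add, map_mul, map_mul, map_mul, map_mul, hfx, hgx]
      ring

theorem initialCon_apply {x : Fin s → R} {n : Fin s → S} {α β : Fin s →₀ ℕ} :
    initialCon F x n α β ↔ monWeight n α = monWeight n β ∧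
      ∃ f ∈ weightLT F n (monWeight n α),
        aeval x f = aeval x (monomial α (1 : F)) - aeval x (monomial β (1 : F)) := Iff.rfl

/- The congruence is finitely generated, so that only the inequalities between weights which occur
in finitely many relations matter. -/
theorem exists_ker_le_initialCon_comp [AddMonoid.FG S] [WellFoundedLT S] {γ : Fin s → S}
    {x : Fin s → R} (hx : AddCon.ker (monWeight γ) ≤ initialCon F x γ) :
    ∃ l : S →+ ℕ, AddCon.ker (monWeight γ) ≤ initialCon F x (l ∘ γ) := by
  have : AddMonoid.FG (Fin s →₀ ℕ) := Module.Finite.iff_addMonoid_fg.mp inferInstance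
  obtain ⟨T, hT, hTker, hTle⟩ := exists_finite_forall_le_addCon (AddCon.ker (monWeight γ))
  choose f hf hfx using fun p hp => (initialCon_apply.mp (hx (hTker p hp))).2
  have h0 : ∀ a : S, 0 ≤ a :=
    IsWellOrderedSemigroup.zero_le ⟨fun _ _ c h => add_lt_add_left h c, wellFounded_lt⟩
  have := hT.to_subtype
  obtain ⟨l, hl⟩ := exists_addMonoidHom_nat_forall_lt h0 (T := ⋃ p : T,
    (fun η => (monWeight γ η, monWeight γ p.1.1)) '' (f p p.2).support)
    (Set.finite_iUnion fun p => (Finset.finite_toSet _).image _)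
    (by
      simp only [Set.mem_iUnion]
      rintro _ ⟨p, η, hη, rfl⟩
      exact mem_weightLT.mp (hf p p.2) η hη)
  refine ⟨l, hTle _ fun p hp => initialCon_apply.mpr ⟨?_, f p hp, mem_weightLT.mpr ?_, hfx p hp⟩⟩
  · rw [monWeight_comp, monWeight_comp, AddCon.ker_apply.mp (hTker p hp)]
  · intro η hη
    rw [monWeight_comp, monWeight_comp]
    exact hl _ (Set.mem_iUnion.mpr ⟨⟨p, hp⟩, η, hη, rfl⟩)

theorem IsOrderFunction.exists_ker_le_initialCon {F : Type*} [Field F] [Algebra F R]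
    [AddMonoid.FG S] [WellFoundedLT S]
    {ρ : R → WithBot S} (h : IsOrderFunction F ρ) {γ : Fin s → S}
    (hγ : AddSubmonoid.closure (Set.range γ) = ⊤) :
    ∃ x : Fin s → R, (∀ i, ρ (x i) = γ i) ∧ AddCon.ker (monWeight γ) ≤ initialCon F x γ := by
  obtain ⟨N, hN, hlt⟩ := h.exists_submonoid_monic
  choose x hxN hx using fun i => hN (γ i)
  have hmem (α : Fin s →₀ ℕ) : aeval x (monomial α (1 : F)) ∈ N := by
    rw [aeval_monomial, _root_.map_one, one_mul]
    exact N.prod_mem fun i _ => pow_mem (hxN i) _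
  refine ⟨x, hx, fun α β hαβ => initialCon_apply.mpr ⟨hαβ, ?_⟩⟩
  refine h.exists_mem_weightLT_aeval_eq hγ hx ((h.mem_ltSubmodule).mpr ?_)
  rw [← h.map_aeval_monomial hx]
  refine hlt _ (hmem α) _ (hmem β) ?_
  rw [h.map_aeval_monomial hx, h.map_aeval_monomial hx, AddCon.ker_apply.mp hαβ]

end InitialForms

section Toric

theorem ker_mapDomainAlgHom {k M N : Type*} [CommRing k] [AddCommMonoid M] [AddCommMonoid N]
    (f : M →+ N) : RingHom.ker (AddMonoidAlgebra.mapDomainAlgHom k k f) =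
      Ideal.span {p | ∃ a b, f a = f b ∧ p = .single a 1 - .single b 1} := by
  refine le_antisymm (fun p hp => ?_) (Ideal.span_le.mpr ?_)
  · have hsub : ∀ q : AddMonoidAlgebra k M,
        q - (q.mapDomain f).mapDomain (Function.invFun f) ∈ Ideal.span
          {p : AddMonoidAlgebra k M | ∃ a b, f a = f b ∧ p = .single a 1 - .single b 1} := by
      intro q
      induction q using AddMonoidAlgebra.induction_linear with
      | zero => simp
      | add q₁ q₂ h₁ h₂ =>
        rw [AddMonoidAlgebra.mapDomain_add, AddMonoidAlgebra.mapDomain_add, add_sub_add_comm]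
        exact add_mem h₁ h₂
      | single a c =>
        have hmul (b : M) : .single a c - .single b c =
            c • (AddMonoidAlgebra.single a 1 - .single b 1 : AddMonoidAlgebra k M) := by
          simp [smul_sub]
        rw [AddMonoidAlgebra.mapDomain_single, AddMonoidAlgebra.mapDomain_single, hmul]
        exact Submodule.smul_of_tower_mem _ c
          (Ideal.subset_span ⟨a, _, (Function.invFun_eq ⟨a, rfl⟩).symm, rfl⟩)
    have hfp : p.mapDomain f = 0 := hp
    simpa only [hfp, AddMonoidAlgebra.mapDomain_zero, sub_zero] using hsub p
  · rintro _ ⟨a, b, hab, rfl⟩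
    rw [SetLike.mem_coe, RingHom.mem_ker, map_sub, sub_eq_zero]
    simp [hab]

section

variable (F : Type*) [CommRing F] {S : Type*} [AddCommMonoid S] {s : ℕ} (γ : Fin s → S)

/-- The homomorphism from the polynomial ring to the semigroup algebra `F[S]` which sends `X^α` to
the basis element of its weight. -/
noncomputable def weightAlgHom : MvPolynomial (Fin s) F →ₐ[F] AddMonoidAlgebra F S :=
  AddMonoidAlgebra.mapDomainAlgHom F F (monWeight γ)

variable {F γ}

theorem weightAlgHom_monomial (α : Fin s →₀ ℕ) (c : F) :
    weightAlgHom F γ (monomial α c) = .single (monWeight γ α) c :=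
  AddMonoidAlgebra.mapDomain_single

theorem weightAlgHom_X (i : Fin s) : weightAlgHom F γ (X i) = .single (γ i) 1 := by
  rw [X, weightAlgHom_monomial, monWeight_single_one]

theorem weightAlgHom_surjective (hγ : AddSubmonoid.closure (Set.range γ) = ⊤) :
    Function.Surjective (weightAlgHom F γ) := by
  intro p
  induction p using AddMonoidAlgebra.induction_linear with
  | zero => exact ⟨0, map_zero _⟩
  | add p q hp hq =>
    obtain ⟨f, rfl⟩ := hp
    obtain ⟨g, rfl⟩ := hq
    exact ⟨f + g, map_add _ f g⟩
  | single w c =>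
    obtain ⟨α, rfl⟩ := monWeight_surjective hγ w
    exact ⟨monomial α c, weightAlgHom_monomial α c⟩

theorem ker_weightAlgHom {F : Type*} [Field F] : RingHom.ker (weightAlgHom F γ) = toricIdeal F γ :=
  ker_mapDomainAlgHom (monWeight γ)

end

section

variable (F : Type*) [Field F] {r : ℕ} (Γ : AddSubmonoid (Fin r → ℕ))

/-- The embedding `F[Γ] → F[T₁, …, T_r]` of the semigroup algebra. -/
noncomputable def toricAlgHom : AddMonoidAlgebra F Γ →ₐ[F] MvPolynomial (Fin r) F :=
  AddMonoidAlgebra.mapDomainAlgHom F F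
    ((Finsupp.linearEquivFunOnFinite ℕ ℕ (Fin r)).symm.toAddMonoidHom.comp Γ.subtype)

variable {F Γ}

theorem toricAlgHom_single_one (w : Γ) : toricAlgHom F Γ (.single w 1) = toricMonomial F w := by
  refine AddMonoidAlgebra.mapDomain_single.trans ((monic_monomial_eq _).trans ?_)
  exact Finsupp.prod_fintype _ _ fun _ => pow_zero _

theorem toricAlgHom_injective : Function.Injective (toricAlgHom F Γ) :=
  AddMonoidAlgebra.mapDomain_injective
    ((Finsupp.linearEquivFunOnFinite ℕ ℕ (Fin r)).symm.injective.comp Subtype.val_injective)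

theorem range_toricAlgHom : (toricAlgHom F Γ).range = toricAlgebra F Γ := by
  refine le_antisymm ?_ (Algebra.adjoin_le ?_)
  · rintro _ ⟨p, rfl⟩
    change toricAlgHom F Γ p ∈ _
    induction p using AddMonoidAlgebra.induction_linear with
    | zero => exact map_zero (toricAlgHom F Γ) ▸ zero_mem _
    | add p q hp hq => exact map_add (toricAlgHom F Γ) p q ▸ add_mem hp hq
    | single w c =>
      rw [← mul_one c, ← smul_eq_mul, ← AddMonoidAlgebra.smul_single, map_smul,
        toricAlgHom_single_one]
      exact Subalgebra.smul_mem _ (Algebra.subset_adjoin (Set.mem_image_of_mem _ w.2)) c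
  · rintro _ ⟨w, hw, rfl⟩
    exact ⟨.single ⟨w, hw⟩ 1, toricAlgHom_single_one ⟨w, hw⟩⟩

variable (F Γ) in
/-- The semigroup algebra `F[Γ]` is isomorphic to the toric algebra of `Γ`. -/
noncomputable def toricAlgEquiv : AddMonoidAlgebra F Γ ≃ₐ[F] toricAlgebra F Γ :=
  (AlgEquiv.ofInjective _ toricAlgHom_injective).trans
    (Subalgebra.equivOfEq _ _ range_toricAlgHom)

theorem coe_toricAlgEquiv_single_one (w : Γ) :
    (toricAlgEquiv F Γ (.single w 1) : MvPolynomial (Fin r) F) = toricMonomial F w :=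
  toricAlgHom_single_one w

end

end Toric

section ReesAlgebra

variable {F : Type*} [Field F] {R : Type*} [CommRing R] [Algebra F R] {s : ℕ}

theorem nonempty_tensorProduct_algEquiv_of_injective {K L A B : Type*} [CommRing K] [CommRing L]
    [Algebra K L] [CommRing A] [Algebra K A] [CommRing B] [Algebra K B] [Algebra L B]
    [IsScalarTower K L B] (M : Submonoid K) [IsLocalization M L] (φ : A →ₐ[K] B)
    (hφ : Function.Injective φ)
    (hsurj : ∀ b, ∃ (m : M) (a : A), algebraMap L B (algebraMap K L m) * b = φ a) :
    Nonempty (L ⊗[K] A ≃ₐ[L] B) := by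
  have : IsLocalizedModule M φ.toLinearMap := by
    refine ⟨fun m => ?_, fun b => ?_, fun h => ⟨1, congrArg _ (hφ h)⟩⟩
    · rw [← (Algebra.lsmul K (A := L) K B).commutes]
      exact (IsLocalization.map_units L m).map _
    · obtain ⟨m, a, h⟩ := hsurj b
      exact ⟨(a, m), (algebraMap_smul L (m : K) b).symm.trans ((Algebra.smul_def _ b).trans h)⟩
  let := φ.toAlgebra
  have : IsScalarTower K A B := .of_algebraMap_eq' φ.comp_algebraMap.symm
  have : Algebra.IsPushout K L A B := ⟨IsLocalizedModule.isBaseChange M L φ.toLinearMap⟩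
  exact ⟨Algebra.IsPushout.equiv K L A B⟩

variable (F) in
/-- The homomorphism `F[t][X₁, …, X_s] → F[t, t⁻¹] ⊗ R` which sends `X_i` to `t^{n_i} x_i`. Its
image is the Rees algebra of the filtration of `R` in which `x_i` has degree `n_i`. -/
noncomputable def reesMap (x : Fin s → R) (n : Fin s → ℕ) :
    MvPolynomial (Fin s) (Polynomial F) →ₐ[Polynomial F] F[T;T⁻¹] ⊗[F] R :=
  aeval fun i => LaurentPolynomial.T (n i : ℤ) ⊗ₜ x i

theorem reesMap_monomial (x : Fin s → R) (n : Fin s → ℕ) (α : Fin s →₀ ℕ) (p : Polynomial F) :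
    reesMap F x n (monomial α p) =
      (Polynomial.toLaurent p * LaurentPolynomial.T (monWeight n α : ℤ)) ⊗ₜ
        aeval x (monomial α (1 : F)) := by
  have hone : reesMap F x n (monomial α 1) =
      LaurentPolynomial.T (monWeight n α : ℤ) ⊗ₜ aeval x (monomial α (1 : F)) := by
    induction α using Finsupp.induction_linear with
    | zero => simp [Algebra.TensorProduct.one_def]
    | add α β hα hβ =>
      have hmul : monomial (α + β) (1 : Polynomial F) = monomial α 1 * monomial β 1 := by
        rw [monomial_mul, one_mul]
      rw [hmul, map_mul, hα, hβ, Algebra.TensorProduct.tmul_mul_tmul, ← map_mul, monomial_mul,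
        one_mul, map_add, Nat.cast_add, LaurentPolynomial.T_add]
    | single i k =>
      rw [reesMap, aeval_monomial, map_one, one_mul, Finsupp.prod_single_index (by simp),
        aeval_monomial, map_one, one_mul, Finsupp.prod_single_index (by simp),
        Algebra.TensorProduct.tmul_pow, LaurentPolynomial.T_pow, monWeight, Finsupp.weight_single,
        smul_eq_mul, Nat.cast_mul]
  rw [← mul_one p, ← smul_eq_mul, ← smul_monomial, map_smul, hone, TensorProduct.smul_tmul',
    Algebra.smul_def, LaurentPolynomial.algebraMap_eq_toLaurent, smul_eq_mul, mul_one]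

theorem exists_T_mul_mem_range_reesMap {x : Fin s → R}
    (hx : Function.Surjective (aeval x : MvPolynomial (Fin s) F →ₐ[F] R)) (n : Fin s → ℕ)
    (z : F[T;T⁻¹] ⊗[F] R) :
    ∃ k : ℕ, (LaurentPolynomial.T (k : ℤ) ⊗ₜ 1) * z ∈ (reesMap F x n).range := by
  have hT (k : ℕ) : LaurentPolynomial.T (k : ℤ) ⊗ₜ 1 ∈ (reesMap F x n).range :=
    ⟨monomial 0 (Polynomial.X ^ k), (reesMap_monomial x n 0 _).trans (by simp)⟩
  have hadd {z z' : F[T;T⁻¹] ⊗[F] R}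
      (hz : ∃ k : ℕ, (LaurentPolynomial.T (k : ℤ) ⊗ₜ 1) * z ∈ (reesMap F x n).range)
      (hz' : ∃ k : ℕ, (LaurentPolynomial.T (k : ℤ) ⊗ₜ 1) * z' ∈ (reesMap F x n).range) :
      ∃ k : ℕ, (LaurentPolynomial.T (k : ℤ) ⊗ₜ 1) * (z + z') ∈ (reesMap F x n).range := by
    obtain ⟨k, hk⟩ := hz
    obtain ⟨k', hk'⟩ := hz'
    refine ⟨k + k', ?_⟩
    have hTadd : (LaurentPolynomial.T ((k + k' : ℕ) : ℤ) ⊗ₜ[F] (1 : R) : F[T;T⁻¹] ⊗[F] R) =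
        LaurentPolynomial.T (k : ℤ) ⊗ₜ 1 * LaurentPolynomial.T (k' : ℤ) ⊗ₜ 1 := by
      rw [Algebra.TensorProduct.tmul_mul_tmul, one_mul, Nat.cast_add, LaurentPolynomial.T_add]
    convert add_mem (mul_mem (hT k') hk) (mul_mem (hT k) hk') using 1
    rw [hTadd]
    ring
  induction z using TensorProduct.induction_on with
  | zero => exact ⟨0, by rw [mul_zero]; exact zero_mem _⟩
  | tmul f r =>
    obtain ⟨g, rfl⟩ := hx r
    induction g using induction_on' with
    | monomial α a =>
      obtain ⟨k, p, hp⟩ := (a • f).exists_T_pow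
      refine ⟨k + monWeight n α, monomial α p, (reesMap_monomial x n α p).trans ?_⟩
      have hsmul : monomial α a = a • monomial α (1 : F) := by
        rw [smul_monomial, smul_eq_mul, mul_one]
      rw [hp, mul_assoc, ← LaurentPolynomial.T_add, hsmul, map_smul, ← TensorProduct.smul_tmul,
        Algebra.TensorProduct.tmul_mul_tmul, one_mul, mul_comm, Nat.cast_add]
    | add g g' hg hg' =>
      rw [map_add, TensorProduct.tmul_add]
      exact hadd hg hg'
  | add z z' hz hz' => exact hadd hz hz'

theorem flat_quotient_ker_reesMap (x : Fin s → R) (n : Fin s → ℕ) :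
    Module.Flat (Polynomial F)
      (MvPolynomial (Fin s) (Polynomial F) ⧸ RingHom.ker (reesMap F x n)) := by
  have : Module.Flat (Polynomial F) F[T;T⁻¹] :=
    IsLocalization.flat F[T;T⁻¹] (Submonoid.powers (Polynomial.X : Polynomial F))
  have : Module.Flat (Polynomial F) (F[T;T⁻¹] ⊗[F] R) :=
    Module.Flat.trans (Polynomial F) F[T;T⁻¹] _
  have : Module.IsTorsionFree (Polynomial F)
      (MvPolynomial (Fin s) (Polynomial F) ⧸ RingHom.ker (reesMap F x n)) :=
    (Ideal.kerLiftAlg_injective (reesMap F x n)).moduleIsTorsionFree _ fun c y => map_smul _ c y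
  infer_instance

theorem nonempty_tensorProduct_quotient_ker_reesMap_algEquiv {x : Fin s → R}
    (hx : Function.Surjective (aeval x : MvPolynomial (Fin s) F →ₐ[F] R)) (n : Fin s → ℕ) :
    Nonempty (F[T;T⁻¹] ⊗[Polynomial F]
      (MvPolynomial (Fin s) (Polynomial F) ⧸ RingHom.ker (reesMap F x n)) ≃ₐ[F[T;T⁻¹]]
        F[T;T⁻¹] ⊗[F] R) := by
  refine nonempty_tensorProduct_algEquiv_of_injective
    (A := MvPolynomial (Fin s) (Polynomial F) ⧸ RingHom.ker (reesMap F x n))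
    (B := F[T;T⁻¹] ⊗[F] R)
    (Submonoid.powers (Polynomial.X : Polynomial F)) (Ideal.kerLiftAlg (reesMap F x n))
    (Ideal.kerLiftAlg_injective (reesMap F x n)) fun z => ?_
  obtain ⟨k, P, hP⟩ := exists_T_mul_mem_range_reesMap hx n z
  refine ⟨⟨_, k, rfl⟩, Ideal.Quotient.mk _ P, Eq.trans ?_ hP.symm⟩
  rw [LaurentPolynomial.algebraMap_X_pow]
  rfl

end ReesAlgebra

section SpecialFibre

variable {F : Type*} [Field F] {R : Type*} [CommRing R] [Algebra F R]
  {S : Type*} [AddCommMonoid S] {s : ℕ} {γ : Fin s → S} {x : Fin s → R} {l : S →+ ℕ}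

variable (F γ) in
/-- The homomorphism `F[t][X₁, …, X_s] → F[S]` with `t ↦ 0` and `X_i ↦ γ_i`. -/
noncomputable def specialMap :
    MvPolynomial (Fin s) (Polynomial F) →ₐ[F] AddMonoidAlgebra F S :=
  (weightAlgHom F γ).comp (mapAlgHom (Polynomial.aeval 0))

theorem specialMap_monomial (α : Fin s →₀ ℕ) (p : Polynomial F) :
    specialMap F γ (monomial α p) = .single (monWeight γ α) (p.coeff 0) := by
  rw [specialMap, AlgHom.comp_apply, mapAlgHom_apply, map_monomial, weightAlgHom_monomial,
    Polynomial.coeff_zero_eq_aeval_zero]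
  rfl

theorem specialMap_surjective (hγ : AddSubmonoid.closure (Set.range γ) = ⊤) :
    Function.Surjective (specialMap F γ) :=
  (weightAlgHom_surjective hγ).comp
    (map_surjective _ fun c => ⟨.C c, Polynomial.aeval_C _ c⟩)

theorem ker_specialMap : RingHom.ker (specialMap F γ) =
    (toricIdeal F γ).map (map Polynomial.C) ⊔
      Ideal.span {(C Polynomial.X : MvPolynomial (Fin s) (Polynomial F))} := by
  let ε : MvPolynomial (Fin s) (Polynomial F) →+* MvPolynomial (Fin s) F :=
    map (Polynomial.evalRingHom 0)
  have hε : Function.Surjective ε := map_surjective _ fun c => ⟨.C c, Polynomial.eval_C⟩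
  have hεC : ε.comp (map Polynomial.C) = RingHom.id _ := by
    ext <;> simp [ε]
  have hker : RingHom.ker ε = Ideal.span {C Polynomial.X} := by
    rw [ker_map, Polynomial.ker_evalRingHom, map_zero, sub_zero, Ideal.map_span,
      Set.image_singleton]
  have hmap : ((toricIdeal F γ).map (map Polynomial.C)).map ε = toricIdeal F γ := by
    rw [Ideal.map_map, hεC, Ideal.map_id]
  calc RingHom.ker (specialMap F γ) = (RingHom.ker (weightAlgHom F γ)).comap ε := rfl
    _ = (((toricIdeal F γ).map (map Polynomial.C)).map ε).comap ε := by
      rw [ker_weightAlgHom, hmap]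
    _ = _ := by
      rw [Ideal.comap_map_of_surjective ε hε, ← hker]
      rfl

theorem exists_mem_span_reesMap_eq {n : Fin s → ℕ} {k : ℕ} {f : MvPolynomial (Fin s) F}
    (hf : f ∈ weightLT F n k) :
    ∃ H ∈ Ideal.span {(C Polynomial.X : MvPolynomial (Fin s) (Polynomial F))},
      reesMap F x n H = LaurentPolynomial.T (k : ℤ) ⊗ₜ aeval x f := by
  have : IsScalarTower F (Polynomial F) F[T;T⁻¹] :=
    .of_algebraMap_eq fun c => (Polynomial.toLaurent_C c).symm
  let M : Submodule F (MvPolynomial (Fin s) F) :=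
    (((Ideal.span {C Polynomial.X}).restrictScalars F).map
      ((reesMap F x n).restrictScalars F).toLinearMap).comap
      (TensorProduct.mk F _ _ (LaurentPolynomial.T (k : ℤ)) ∘ₗ (aeval x).toLinearMap)
  suffices weightLT F n k ≤ M from this hf
  refine weightLT_le_iff.mpr fun β hβ => ?_
  refine ⟨monomial β (Polynomial.X ^ (k - monWeight n β)), ?_, (reesMap_monomial x n β _).trans ?_⟩
  · refine Ideal.mem_span_singleton.mpr ⟨monomial β (Polynomial.X ^ (k - monWeight n β - 1)), ?_⟩
    rw [C_mul_monomial, ← pow_succ', Nat.sub_add_cancel (Nat.sub_pos_of_lt hβ)]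
  · rw [map_pow, Polynomial.toLaurent_X, LaurentPolynomial.T_pow, ← LaurentPolynomial.T_add,
      mul_one, ← Nat.cast_add, Nat.sub_add_cancel hβ.le]
    rfl

theorem ker_specialMap_le (hx : AddCon.ker (monWeight γ) ≤ initialCon F x (l ∘ γ)) :
    RingHom.ker (specialMap F γ) ≤
      RingHom.ker (reesMap F x (l ∘ γ)) ⊔ Ideal.span {C Polynomial.X} := by
  rw [ker_specialMap, toricIdeal, Ideal.map_span]
  refine sup_le (Ideal.span_le.mpr ?_) le_sup_right
  rintro _ ⟨_, ⟨α, β, hαβ, rfl⟩, rfl⟩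
  obtain ⟨hw, f, hf, hfx⟩ := initialCon_apply.mp (hx hαβ)
  obtain ⟨H, hH, hHf⟩ := exists_mem_span_reesMap_eq (x := x) hf
  refine Submodule.mem_sup.mpr ⟨_, ?_, H, hH, sub_add_cancel _ H⟩
  rw [RingHom.mem_ker, map_sub, sub_eq_zero, hHf, map_sub, map_monomial, map_monomial, map_one,
    map_sub, reesMap_monomial, reesMap_monomial, hfx, hw, map_one, one_mul,
    TensorProduct.tmul_sub]

theorem aeval_mem_span_of_mem_weightLT {y : S → R}
    (hy : ∀ α, ∃ f ∈ weightLT F (l ∘ γ) (l (monWeight γ α)),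
      aeval x f = aeval x (monomial α (1 : F)) - y (monWeight γ α))
    {k : ℕ} {f : MvPolynomial (Fin s) F} (hf : f ∈ weightLT F (l ∘ γ) k) :
    aeval x f ∈ Submodule.span F (y '' {w | l w < k}) := by
  induction k using Nat.strong_induction_on generalizing f with
  | _ k ih =>
  suffices weightLT F (l ∘ γ) k ≤
    (Submodule.span F (y '' {w | l w < k})).comap (aeval x).toLinearMap from this hf
  refine weightLT_le_iff.mpr fun β hβ => ?_
  rw [monWeight_comp] at hβ
  obtain ⟨g, hg, hgx⟩ := hy β
  rw [Submodule.mem_comap, AlgHom.toLinearMap_apply, ← add_eq_of_eq_sub hgx]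
  exact add_mem (Submodule.span_mono (Set.image_mono fun w hw => hw.trans hβ) (ih _ hβ hg))
    (Submodule.subset_span (Set.mem_image_of_mem y hβ))

theorem coeff_toLaurent_mul_T {A : Type*} [Semiring A] (p : Polynomial A) (k : ℕ) {m : ℤ}
    (hm : m ≤ k) :
    (Polynomial.toLaurent p * LaurentPolynomial.T (k : ℤ)).coeff m =
      if m = k then p.coeff 0 else 0 := by
  rw [LaurentPolynomial.T, AddMonoidAlgebra.coeff_mul_single_apply, mul_one,
    LaurentPolynomial.coeff_toLaurent]
  split_ifs with h
  · rw [h, add_neg_cancel]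
    exact Finsupp.mapDomain_apply Nat.cast_injective _ 0
  · refine Finsupp.mapDomain_of_notMem_range _ _ ?_
    rintro ⟨j, hj⟩
    rw [Nat.castEmbedding_apply] at hj
    omega

theorem top_le_span_range_of_aeval_surjective {y : S → R}
    (hsurj : Function.Surjective (aeval x : MvPolynomial (Fin s) F →ₐ[F] R))
    (hy : ∀ α, ∃ f ∈ weightLT F (l ∘ γ) (l (monWeight γ α)),
      aeval x f = aeval x (monomial α (1 : F)) - y (monWeight γ α)) :
    ⊤ ≤ Submodule.span F (Set.range y) := by
  rintro r -
  obtain ⟨f, rfl⟩ := hsurj r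
  refine Submodule.span_mono (Set.image_subset_range _ _)
    (aeval_mem_span_of_mem_weightLT hy (k := f.support.sup (monWeight (l ∘ γ)) + 1) ?_)
  exact fun α hα => Nat.lt_succ_of_le (Finset.le_sup (f := monWeight (l ∘ γ)) hα)

/- A linear map that reads off the coefficient of `t ^ l w ⊗ y w`, for all `w`, recovers
`specialMap` from `reesMap`. -/
theorem ker_reesMap_le {y : S → R} (hli : LinearIndependent F y)
    (htop : ⊤ ≤ Submodule.span F (Set.range y))
    (hy : ∀ α, ∃ f ∈ weightLT F (l ∘ γ) (l (monWeight γ α)),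
      aeval x f = aeval x (monomial α (1 : F)) - y (monWeight γ α)) :
    RingHom.ker (reesMap F x (l ∘ γ)) ≤ RingHom.ker (specialMap F γ) := by
  let b := Module.Basis.mk hli htop
  let φ : F[T;T⁻¹] ⊗[F] R →ₗ[F] AddMonoidAlgebra F S := TensorProduct.lift
    ((b.constr F).toLinearMap ∘ₗ LinearMap.pi fun w => AddMonoidAlgebra.lsingle w ∘ₗ
      Finsupp.lapply (l w : ℤ) ∘ₗ (AddMonoidAlgebra.coeffLinearEquiv F).toLinearMap)
  have hφ (q : F[T;T⁻¹]) (w : S) : φ (q ⊗ₜ y w) = .single w (q.coeff (l w)) := by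
    rw [← Module.Basis.mk_apply hli htop w]
    exact b.constr_basis F _ w
  have hφ_lt (p : Polynomial F) (k : ℕ) {r : R} (hr : r ∈ Submodule.span F (y '' {w | l w < k})) :
      φ ((Polynomial.toLaurent p * LaurentPolynomial.T (k : ℤ)) ⊗ₜ r) = 0 := by
    suffices Submodule.span F (y '' {w | l w < k}) ≤ LinearMap.ker
      (φ ∘ₗ TensorProduct.mk F _ R (Polynomial.toLaurent p * LaurentPolynomial.T (k : ℤ))) from
      this hr
    rw [Submodule.span_le, Set.image_subset_iff]
    intro w hw
    refine LinearMap.mem_ker.mpr ((hφ _ w).trans ?_)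
    rw [coeff_toLaurent_mul_T p k (Nat.cast_le.mpr hw.le), if_neg (by exact_mod_cast hw.ne),
      AddMonoidAlgebra.single_zero]
  have hφ_rees (P : MvPolynomial (Fin s) (Polynomial F)) :
      φ (reesMap F x (l ∘ γ) P) = specialMap F γ P := by
    induction P using induction_on' with
    | monomial α p =>
      obtain ⟨f, hf, hfx⟩ := hy α
      rw [reesMap_monomial, specialMap_monomial, ← add_eq_of_eq_sub hfx, TensorProduct.tmul_add,
        map_add, monWeight_comp, hφ_lt _ _ (aeval_mem_span_of_mem_weightLT hy hf), zero_add, hφ,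
        coeff_toLaurent_mul_T p _ le_rfl, if_pos rfl]
    | add P Q hP hQ => rw [map_add, map_add, map_add, hP, hQ]
  intro P hP
  rw [RingHom.mem_ker] at hP ⊢
  rw [← hφ_rees, hP, map_zero]

end SpecialFibre

section Deformation

variable {F : Type*} [Field F] {R : Type*} [CommRing R] [Algebra F R]
  {S : Type*} [AddCommMonoid S] {s : ℕ} {γ : Fin s → S}

theorem isFlatDeformation_reesMap {x : Fin s → R} {l : S →+ ℕ} {y : S → R}
    (hγ : AddSubmonoid.closure (Set.range γ) = ⊤)
    (hsurj : Function.Surjective (aeval x : MvPolynomial (Fin s) F →ₐ[F] R))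
    (hl : AddCon.ker (monWeight γ) ≤ initialCon F x (l ∘ γ)) (hli : LinearIndependent F y)
    (hy : ∀ α, ∃ f ∈ weightLT F (l ∘ γ) (l (monWeight γ α)),
      aeval x f = aeval x (monomial α (1 : F)) - y (monWeight γ α)) :
    IsFlatDeformation F (MvPolynomial (Fin s) (Polynomial F) ⧸ RingHom.ker (reesMap F x (l ∘ γ)))
      R (AddMonoidAlgebra F S) := by
  refine ⟨flat_quotient_ker_reesMap x _, ?_,
    nonempty_tensorProduct_quotient_ker_reesMap_algEquiv hsurj _⟩
  have hker : RingHom.ker (reesMap F x (l ∘ γ)) ⊔ Ideal.span {C Polynomial.X} =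
      RingHom.ker (specialMap F γ) :=
    le_antisymm (sup_le (ker_reesMap_le hli (top_le_span_range_of_aeval_surjective hsurj hy) hy)
      (le_sup_right.trans ker_specialMap.ge)) (ker_specialMap_le hl)
  have hspan : Ideal.span {algebraMap (Polynomial F)
      (MvPolynomial (Fin s) (Polynomial F) ⧸ RingHom.ker (reesMap F x (l ∘ γ))) Polynomial.X} =
      (Ideal.span {C Polynomial.X}).map (Ideal.Quotient.mkₐ F _) := by
    rw [Ideal.map_span, Set.image_singleton]
    rfl
  rw [hspan]
  exact ⟨(DoubleQuot.quotQuotEquivQuotSupₐ F _ _).trans <|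
    (Ideal.quotientEquivAlgOfEq F hker).trans <|
    Ideal.quotientKerAlgEquivOfSurjective (specialMap_surjective hγ)⟩

theorem IsOrderFunction.hasFlatDeformation [LinearOrder S] [IsOrderedCancelAddMonoid S]
    [WellFoundedLT S] [AddMonoid.FG S] {ρ : R → WithBot S} (h : IsOrderFunction F ρ) :
    HasFlatDeformation F R (AddMonoidAlgebra F S) := by
  obtain ⟨t, ht⟩ := AddMonoid.FG.fg_top (M := S)
  let γ : Fin t.card → S := fun i => t.equivFin.symm i
  have hγ : AddSubmonoid.closure (Set.range γ) = ⊤ := by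
    rw [← ht]
    congr 1
    exact (EquivLike.range_comp _ t.equivFin.symm).trans Subtype.range_coe
  obtain ⟨x, hxγ, hx⟩ := h.exists_ker_le_initialCon hγ
  obtain ⟨l, hl⟩ := exists_ker_le_initialCon_comp hx
  choose σ hσ using monWeight_surjective hγ
  have hli : LinearIndependent F fun w => aeval x (monomial (σ w) (1 : F)) :=
    h.linearIndependent fun w => by rw [h.map_aeval_monomial hxγ, hσ]
  refine ⟨_, _, isFlatDeformation_reesMap hγ (h.aeval_surjective hγ hxγ) hl hli fun α => ?_⟩
  have hα : AddCon.ker (monWeight γ) α (σ (monWeight γ α)) := (hσ _).symm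
  rw [← monWeight_comp]
  exact (initialCon_apply.mp (hl hα)).2

theorem HasFlatDeformation.congr_right {R₀ R₁ : Type*} [CommRing R₀] [Algebra F R₀] [CommRing R₁]
    [Algebra F R₁] (h : HasFlatDeformation F R R₀) (e : R₀ ≃ₐ[F] R₁) :
    HasFlatDeformation F R R₁ := by
  obtain ⟨n, J, hflat, ⟨e₀⟩, hgen⟩ := h
  exact ⟨n, J, hflat, ⟨e₀.trans e⟩, hgen⟩

end Deformation

section NormalForm

variable {F : Type*} [Field F] {s : ℕ} {m : MonomialOrder (Fin s)}
  {I : Ideal (MvPolynomial (Fin s) F)} {f : MvPolynomial (Fin s) F} {α β : Fin s →₀ ℕ}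

theorem degree_notMem_standardMonomials (hf : f ∈ I) (hf0 : f ≠ 0) :
    m.degree f ∉ standardMonomials m I :=
  not_not.mpr ⟨f, hf, hf0, rfl⟩

theorem isLowerSet_standardMonomials : IsLowerSet (standardMonomials m I) := by
  rintro α β hle hα ⟨f, hf, hf0, rfl⟩
  have hmon : monomial (α - m.degree f) (1 : F) ≠ 0 := by simp
  classical
  refine hα ⟨monomial (α - m.degree f) 1 * f, I.mul_mem_left _ hf, mul_ne_zero hmon hf0, ?_⟩
  rw [m.degree_mul hmon hf0, m.degree_monomial, if_neg one_ne_zero, tsub_add_cancel_of_le hle]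

theorem exists_sub_mem_restrictSupport_standardMonomials (m : MonomialOrder (Fin s))
    (I : Ideal (MvPolynomial (Fin s) F)) (f : MvPolynomial (Fin s) F) :
    ∃ r, f - r ∈ I ∧ r ∈ restrictSupport F (standardMonomials m I) ∧
      m.toSyn (m.degree r) ≤ m.toSyn (m.degree f) := by
  obtain ⟨g, r, hfr, hg, hr⟩ := m.div_set (B := {b | b ∈ I ∧ b ≠ 0})
    (fun b hb => by simpa using hb.2) f
  rw [← sub_eq_iff_eq_add, Finsupp.linearCombination_apply, Finsupp.sum] at hfr
  have hdeg : m.toSyn (m.degree (f - r)) ≤ m.toSyn (m.degree f) := by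
    rw [hfr]
    exact m.degree_sum_le.trans (Finset.sup_le fun b _ => by simpa [mul_comm] using hg b)
  refine ⟨r, ?_, ?_, ?_⟩
  · rw [hfr]
    exact I.sum_mem fun b _ => I.mul_mem_left _ b.2.1
  · rintro α hα ⟨b, hb, hb0, rfl⟩
    exact hr _ hα b ⟨hb, hb0⟩ le_rfl
  · rw [← sub_sub_cancel f r]
    exact m.degree_sub_le.trans (sup_le le_rfl hdeg)

theorem isCompl_restrictSupport_standardMonomials (m : MonomialOrder (Fin s))
    (I : Ideal (MvPolynomial (Fin s) F)) :
    IsCompl (restrictSupport F (standardMonomials m I)) (I.restrictScalars F) := by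
  refine ⟨Submodule.disjoint_def.mpr fun f hf hfI => ?_,
    codisjoint_iff.mpr (eq_top_iff.mpr fun f _ => ?_)⟩
  · by_contra hf0
    exact degree_notMem_standardMonomials hfI hf0 (hf ((m.degree_mem_support_iff f).mpr hf0))
  · obtain ⟨r, hI, hr, -⟩ := exists_sub_mem_restrictSupport_standardMonomials m I f
    rw [← add_sub_cancel r f]
    exact Submodule.add_mem_sup hr hI

/-- The remainder modulo `I` with respect to the monomial order `m`: the unique polynomial that is
congruent to the given one modulo `I` and only involves standard monomials. -/
noncomputable def normalForm (m : MonomialOrder (Fin s)) (I : Ideal (MvPolynomial (Fin s) F)) :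
    MvPolynomial (Fin s) F →ₗ[F] MvPolynomial (Fin s) F :=
  Submodule.projection _ _ (isCompl_restrictSupport_standardMonomials m I)

theorem sub_normalForm_mem (f : MvPolynomial (Fin s) F) : f - normalForm m I f ∈ I :=
  Submodule.sub_projection_mem (isCompl_restrictSupport_standardMonomials m I) f

theorem normalForm_mem_restrictSupport (f : MvPolynomial (Fin s) F) :
    normalForm m I f ∈ restrictSupport F (standardMonomials m I) :=
  Submodule.projection_apply_mem (isCompl_restrictSupport_standardMonomials m I) f

theorem mem_standardMonomials_of_mem_support_normalForm (h : α ∈ (normalForm m I f).support) :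
    α ∈ standardMonomials m I :=
  normalForm_mem_restrictSupport f h

theorem coeff_normalForm_eq_zero (h : α ∉ standardMonomials m I) :
    (normalForm m I f).coeff α = 0 :=
  notMem_support_iff.mp (mt mem_standardMonomials_of_mem_support_normalForm h)

theorem normalForm_eq_self (hf : f ∈ restrictSupport F (standardMonomials m I)) :
    normalForm m I f = f :=
  Submodule.projection_apply_of_mem_left (isCompl_restrictSupport_standardMonomials m I) hf

theorem normalForm_eq_zero_iff : normalForm m I f = 0 ↔ f ∈ I :=
  Submodule.projection_apply_eq_zero_iff (isCompl_restrictSupport_standardMonomials m I)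

theorem normalForm_eq_of_sub_mem {g : MvPolynomial (Fin s) F} (h : f - g ∈ I) :
    normalForm m I f = normalForm m I g := by
  rwa [← sub_eq_zero, ← map_sub, normalForm_eq_zero_iff]

theorem toSyn_degree_normalForm_le (f : MvPolynomial (Fin s) F) :
    m.toSyn (m.degree (normalForm m I f)) ≤ m.toSyn (m.degree f) := by
  obtain ⟨r, hI, hr, hdeg⟩ := exists_sub_mem_restrictSupport_standardMonomials m I f
  rwa [normalForm_eq_of_sub_mem hI, normalForm_eq_self hr]

theorem toSyn_le_of_mem_support_normalForm_monomial {c : F}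
    (h : β ∈ (normalForm m I (monomial α c)).support) : m.toSyn β ≤ m.toSyn α :=
  (m.le_degree h).trans ((toSyn_degree_normalForm_le _).trans (m.degree_monomial_le c))

theorem mem_support_monomial_sub_normalForm_iff (hα : α ∉ standardMonomials m I) :
    β ∈ (monomial α 1 - normalForm m I (monomial α 1)).support ↔
      β = α ∨ β ∈ (normalForm m I (monomial α 1)).support := by
  classical
  rw [mem_support_iff, coeff_sub, coeff_monomial, mem_support_iff]
  rcases eq_or_ne α β with rfl | hβ
  · simp [coeff_normalForm_eq_zero hα]
  · simp [hβ, hβ.symm]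

theorem degree_monomial_sub_normalForm (hα : α ∉ standardMonomials m I) :
    m.degree (monomial α 1 - normalForm m I (monomial α 1)) = α := by
  refine m.toSyn.injective (le_antisymm (m.degree_le_iff.mpr fun β hβ => ?_)
    (m.le_degree ((mem_support_monomial_sub_normalForm_iff hα).mpr (.inl rfl))))
  rcases (mem_support_monomial_sub_normalForm_iff hα).mp hβ with rfl | hβ
  exacts [le_rfl, toSyn_le_of_mem_support_normalForm_monomial hβ]

theorem leadingCoeff_monomial_sub_normalForm (hα : α ∉ standardMonomials m I) :
    m.leadingCoeff (monomial α 1 - normalForm m I (monomial α 1)) = 1 := by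
  rw [MonomialOrder.leadingCoeff, degree_monomial_sub_normalForm hα, coeff_sub,
    coeff_normalForm_eq_zero hα, sub_zero, coeff_monomial, if_pos rfl]

theorem exists_isReducedGroebnerBasis (m : MonomialOrder (Fin s))
    (I : Ideal (MvPolynomial (Fin s) F)) :
    ∃ G, IsReducedGroebnerBasis m I G ∧ ∀ g ∈ G, ∃ α ∉ standardMonomials m I,
      g = monomial α 1 - normalForm m I (monomial α 1) := by
  classical
  let g (α : Fin s →₀ ℕ) := monomial α 1 - normalForm m I (monomial α 1)
  have hfin : {α | Minimal (· ∉ standardMonomials m I) α}.Finite :=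
    WellQuasiOrderedLE.finite_of_isAntichain (setOfPred_minimal_antichain _)
  have hmin {α} : α ∈ hfin.toFinset ↔ Minimal (· ∉ standardMonomials m I) α :=
    hfin.mem_toFinset
  refine ⟨hfin.toFinset.image g, ⟨?_, ?_, ?_, ?_⟩, ?_⟩
  · exact Finset.forall_mem_image.mpr fun α _ => sub_normalForm_mem _
  · intro f hf hf0
    obtain ⟨α, hle, hα⟩ := exists_minimal_le_of_wellFoundedLT (· ∉ standardMonomials m I)
      (m.degree f) (degree_notMem_standardMonomials hf hf0)
    refine ⟨g α, Finset.mem_image_of_mem g (hmin.mpr hα), ?_⟩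
    rwa [degree_monomial_sub_normalForm hα.prop]
  · exact Finset.forall_mem_image.mpr fun α hα =>
      leadingCoeff_monomial_sub_normalForm (hmin.mp hα).prop
  · refine Finset.forall_mem_image.mpr fun α hα =>
      Finset.forall_mem_image.mpr fun β hβ hne δ hδ hle => ?_
    rw [degree_monomial_sub_normalForm (hmin.mp hβ).prop] at hle
    rcases (mem_support_monomial_sub_normalForm_iff (hmin.mp hα).prop).mp hδ with rfl | hδ
    · exact hne (congrArg g ((hmin.mp hα).eq_of_le (hmin.mp hβ).prop hle))
    · exact (hmin.mp hβ).prop (isLowerSet_standardMonomials hle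
        (mem_standardMonomials_of_mem_support_normalForm hδ))
  · exact Finset.forall_mem_image.mpr fun α hα => ⟨α, (hmin.mp hα).prop, rfl⟩

end NormalForm

section TopWeight

variable {F : Type*} [Field F] {S : Type*} [AddCommMonoid S] [LinearOrder S] {s : ℕ}
  {γ : Fin s → S} {f g : MvPolynomial (Fin s) F} {δ ε : Fin s →₀ ℕ} {c d : F} {v w : S}

/-- The maximal weight of a monomial of `f`, which is `⊥` for `f = 0`. -/
noncomputable def topWeight (γ : Fin s → S) (f : MvPolynomial (Fin s) F) : WithBot S :=
  f.support.sup fun β => (monWeight γ β : WithBot S)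

theorem topWeight_lt_coe_iff : topWeight γ f < w ↔ f ∈ weightLT F γ w := by
  simp only [topWeight, Finset.sup_lt_iff (WithBot.bot_lt_coe w), WithBot.coe_lt_coe,
    mem_weightLT]

theorem topWeight_le_coe_iff :
    topWeight γ f ≤ w ↔ ∀ β ∈ f.support, monWeight γ β ≤ w := by
  simp only [topWeight, Finset.sup_le_iff, WithBot.coe_le_coe]

theorem topWeight_eq_bot_iff : topWeight γ f = ⊥ ↔ f = 0 := by
  simp only [topWeight, Finset.sup_eq_bot_iff, WithBot.coe_ne_bot, imp_false,
    ← Finset.eq_empty_iff_forall_notMem, support_eq_empty]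

theorem exists_mem_support_of_topWeight_eq_coe (h : topWeight γ f = w) :
    ∃ δ ∈ f.support, monWeight γ δ = w := by
  have hf : f ≠ 0 := fun hf => by simp [topWeight_eq_bot_iff.mpr hf] at h
  obtain ⟨δ, hδ, hsup⟩ := Finset.exists_mem_eq_sup f.support (support_nonempty.mpr hf)
    fun β => (monWeight γ β : WithBot S)
  exact ⟨δ, hδ, WithBot.coe_injective (hsup.symm.trans h)⟩

theorem topWeight_smul (hc : c ≠ 0) (f : MvPolynomial (Fin s) F) :
    topWeight γ (c • f) = topWeight γ f := by
  rw [topWeight, support_smul_eq hc, topWeight]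

theorem topWeight_monomial (hc : c ≠ 0) : topWeight γ (monomial δ c) = monWeight γ δ := by
  classical
  rw [topWeight, support_monomial, if_neg hc, Finset.sup_singleton]

theorem topWeight_add_le (f g : MvPolynomial (Fin s) F) :
    topWeight γ (f + g) ≤ max (topWeight γ f) (topWeight γ g) := by
  classical
  exact (Finset.sup_mono support_add).trans_eq Finset.sup_union

theorem topWeight_add_eq_left (h : topWeight γ g < topWeight γ f) :
    topWeight γ (f + g) = topWeight γ f := by
  refine ((topWeight_add_le f g).trans_eq (max_eq_left h.le)).antisymm (not_lt.mp fun hlt => ?_)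
  have hf : topWeight γ f ≤ max (topWeight γ (f + g)) (topWeight γ ((-1 : F) • g)) := by
    simpa using topWeight_add_le (γ := γ) (f + g) ((-1 : F) • g)
  rw [topWeight_smul (neg_ne_zero.mpr one_ne_zero)] at hf
  exact hf.not_gt (max_lt hlt h)

theorem sub_monomial_mem_weightLT {A : Set (Fin s →₀ ℕ)} (hA : A.InjOn (monWeight γ))
    (hf : f ∈ restrictSupport F A) (hδ : δ ∈ A) (hw : topWeight γ f ≤ monWeight γ δ) :
    f - monomial δ (f.coeff δ) ∈ weightLT F γ (monWeight γ δ) := by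
  classical
  refine mem_weightLT.mpr fun β hβ => ?_
  have hne : δ ≠ β := by
    rintro rfl
    simp [mem_support_iff] at hβ
  rw [mem_support_iff, coeff_sub, coeff_monomial, if_neg hne, sub_zero, ← mem_support_iff] at hβ
  exact (topWeight_le_coe_iff.mp hw β hβ).lt_of_ne fun h => hne (hA (hf hβ) hδ h).symm

variable [IsOrderedCancelAddMonoid S]

theorem mul_mem_weightLT (hf : f ∈ weightLT F γ v) (hg : g ∈ weightLT F γ w) :
    f * g ∈ weightLT F γ (v + w) := by
  suffices weightLT F γ v ≤ (weightLT F γ (v + w)).comap (LinearMap.mulRight F g) from this hf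
  refine weightLT_le_iff.mpr fun β hβ => weightLT_mono ?_ (monomial_mul_mem_weightLT β 1 hg)
  gcongr

theorem mul_sub_monomial_mem_weightLT
    (hf : f - monomial δ c ∈ weightLT F γ (monWeight γ δ))
    (hg : g - monomial ε d ∈ weightLT F γ (monWeight γ ε)) :
    f * g - monomial (δ + ε) (c * d) ∈ weightLT F γ (monWeight γ (δ + ε)) := by
  have hfg : f * g - monomial (δ + ε) (c * d) = monomial δ c * (g - monomial ε d) +
      monomial ε d * (f - monomial δ c) + (f - monomial δ c) * (g - monomial ε d) := by
    rw [← monomial_mul]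
    ring
  rw [hfg, map_add]
  refine add_mem (add_mem (monomial_mul_mem_weightLT δ c hg) ?_) (mul_mem_weightLT hf hg)
  rw [add_comm (monWeight γ δ)]
  exact monomial_mul_mem_weightLT ε d hf

end TopWeight

section GeilPellikaan

variable {F : Type*} [Field F] {S : Type*} [AddCommMonoid S] [LinearOrder S]
  {hS : IsWellOrderedSemigroup S} {s : ℕ} {γ : Fin s → S} {τ : MonomialOrder (Fin s)}
  {I : Ideal (MvPolynomial (Fin s) F)} {f : MvPolynomial (Fin s) F} {α β : Fin s →₀ ℕ} {w : S}

theorem monWeight_le_of_weightOrder_le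
    (h : (weightOrder hS γ τ).toSyn α ≤ (weightOrder hS γ τ).toSyn β) :
    monWeight γ α ≤ monWeight γ β := by
  contrapose! h
  exact (weightOrder_lt_iff hS γ τ β α).mpr (.inl h)

theorem topWeight_normalForm_monomial_le (α : Fin s →₀ ℕ) :
    topWeight γ (normalForm (weightOrder hS γ τ) I (monomial α 1)) ≤ monWeight γ α :=
  topWeight_le_coe_iff.mpr fun _ hβ =>
    monWeight_le_of_weightOrder_le (toSyn_le_of_mem_support_normalForm_monomial hβ)

theorem normalForm_mem_weightLT (hf : f ∈ weightLT F γ w) :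
    normalForm (weightOrder hS γ τ) I f ∈ weightLT F γ w := by
  suffices weightLT F γ w ≤ (weightLT F γ w).comap (normalForm (weightOrder hS γ τ) I) from
    this hf
  exact weightLT_le_iff.mpr fun β hβ => topWeight_lt_coe_iff.mp
    ((topWeight_normalForm_monomial_le β).trans_lt (WithBot.coe_lt_coe.mpr hβ))

theorem topWeight_normalForm_eq {c : F} (hc : c ≠ 0)
    (hβ : topWeight γ (normalForm (weightOrder hS γ τ) I (monomial β 1)) = monWeight γ β)
    (hf : f - monomial β c ∈ weightLT F γ (monWeight γ β)) :
    topWeight γ (normalForm (weightOrder hS γ τ) I f) = monWeight γ β := by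
  rw [← topWeight_smul hc] at hβ
  have hfc : f = c • monomial β 1 + (f - monomial β c) := by
    rw [smul_monomial, smul_eq_mul, mul_one, add_sub_cancel]
  rw [hfc, map_add, map_smul, topWeight_add_eq_left, hβ]
  exact (topWeight_lt_coe_iff.mpr (normalForm_mem_weightLT hf)).trans_eq hβ.symm

theorem exists_sub_sub_mem_weightLT_of_ncard_eq_two {g : MvPolynomial (Fin s) F}
    (hg : (weightOrder hS γ τ).leadingCoeff g = 1) (hα : (weightOrder hS γ τ).degree g = α)
    (h2 : {α | α ∈ g.support ∧ ∀ β ∈ g.support, monWeight γ β ≤ monWeight γ α}.ncard = 2) :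
    ∃ (ν : Fin s →₀ ℕ) (c : F), c ≠ 0 ∧ monWeight γ ν = monWeight γ α ∧
      (weightOrder hS γ τ).toSyn ν < (weightOrder hS γ τ).toSyn α ∧
      g - monomial α 1 - monomial ν c ∈ weightLT F γ (monWeight γ α) := by
  classical
  set A := {α | α ∈ g.support ∧ ∀ β ∈ g.support, monWeight γ β ≤ monWeight γ α}
  have hgα : g.coeff α = 1 := by rw [← hg, ← hα, MonomialOrder.leadingCoeff]
  have hle {β} (hβ : β ∈ g.support) :
      (weightOrder hS γ τ).toSyn β ≤ (weightOrder hS γ τ).toSyn α :=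
    hα ▸ (weightOrder hS γ τ).le_degree hβ
  have hαA : α ∈ A := ⟨by simp [mem_support_iff, hgα], fun β hβ =>
    monWeight_le_of_weightOrder_le (hle hβ)⟩
  obtain ⟨ν, hνA, hνα, hpair⟩ : ∃ ν ∈ A, ν ≠ α ∧ A = {α, ν} := by
    obtain ⟨ν, hν⟩ := Set.ncard_eq_one.mp
      (show (A \ {α}).ncard = 1 by rw [Set.ncard_sdiff_singleton_of_mem hαA, h2])
    have hνA : ν ∈ A \ {α} := hν ▸ rfl
    refine ⟨ν, hνA.1, hνA.2, ?_⟩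
    rw [← hν, Set.insert_sdiff_singleton, Set.insert_eq_of_mem hαA]
  refine ⟨ν, g.coeff ν, mem_support_iff.mp hνA.1, (hαA.2 ν hνA.1).antisymm (hνA.2 α hαA.1),
    (hle hνA.1).lt_of_ne ((weightOrder hS γ τ).toSyn.injective.ne hνα),
    mem_weightLT.mpr fun β hβ => ?_⟩
  have hβα : α ≠ β := by
    rintro rfl
    simp [coeff_monomial, hgα, hνα] at hβ
  have hβν : ν ≠ β := by
    rintro rfl
    simp [coeff_monomial, hβα] at hβ
  rw [mem_support_iff, coeff_sub, coeff_sub, coeff_monomial, coeff_monomial, if_neg hβα,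
    if_neg hβν, sub_zero, sub_zero, ← mem_support_iff] at hβ
  refine (hαA.2 β hβ).lt_of_ne fun h => ?_
  have hβA : β ∈ A := ⟨hβ, fun δ hδ => (hαA.2 δ hδ).trans_eq h.symm⟩
  rw [hpair] at hβA
  exact hβA.elim hβα.symm hβν.symm

theorem IsGeilPellikaanForm.topWeight_normalForm_monomial (hI : IsGeilPellikaanForm hS γ τ I)
    (α : Fin s →₀ ℕ) :
    topWeight γ (normalForm (weightOrder hS γ τ) I (monomial α 1)) = monWeight γ α := by
  have := hS.isOrderedCancelAddMonoid
  obtain ⟨⟨G, hG, h2⟩, -⟩ := hI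
  have := (weightOrder hS γ τ).wellFoundedLT_syn
  induction hα : (weightOrder hS γ τ).toSyn α using WellFoundedLT.induction generalizing α with
  | _ v ih =>
  subst hα
  by_cases hα : α ∈ standardMonomials (weightOrder hS γ τ) I
  · rw [normalForm_eq_self ((monomial_mem_restrictSupport F).mpr (.inl hα)),
      topWeight_monomial one_ne_zero]
  obtain ⟨f, hf, hf0, rfl⟩ := not_not.mp hα
  obtain ⟨g, hg, hle⟩ := hG.exists_degree_le f hf hf0
  obtain ⟨ν, c, hc, hν, hlt, hlow⟩ :=
    exists_sub_sub_mem_weightLT_of_ncard_eq_two (hG.monic g hg) rfl (h2 g hg)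
  obtain ⟨η, hη⟩ := exists_add_of_le hle
  rw [add_comm] at hη
  have hlow' : monomial ((weightOrder hS γ τ).degree f) 1 - monomial η 1 * g -
      monomial (η + ν) (-c) ∈ weightLT F γ (monWeight γ (η + ν)) := by
    rw [map_add, hν]
    convert neg_mem (monomial_mul_mem_weightLT η 1 hlow) using 1
    rw [hη, mul_sub, mul_sub, monomial_mul, monomial_mul, one_mul, one_mul, map_neg]
    ring
  have hcongr : monomial ((weightOrder hS γ τ).degree f) 1 -
      (monomial ((weightOrder hS γ τ).degree f) 1 - monomial η 1 * g) ∈ I := by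
    rw [sub_sub_cancel]
    exact I.mul_mem_left _ (hG.mem g hg)
  rw [normalForm_eq_of_sub_mem hcongr, topWeight_normalForm_eq (neg_ne_zero.mpr hc)
    (ih _ (by rw [hη, map_add, map_add]; gcongr) (η + ν) rfl) hlow', hη, map_add, map_add, hν]

theorem isGeilPellikaanForm_of_topWeight_normalForm_monomial
    (hinj : (standardMonomials (weightOrder hS γ τ) I).InjOn (monWeight γ))
    (htop : ∀ α, topWeight γ (normalForm (weightOrder hS γ τ) I (monomial α 1)) = monWeight γ α) :
    IsGeilPellikaanForm hS γ τ I := by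
  obtain ⟨G, hG, hform⟩ := exists_isReducedGroebnerBasis (weightOrder hS γ τ) I
  refine ⟨⟨G, hG, fun g hg => ?_⟩, hinj⟩
  obtain ⟨α, hα, rfl⟩ := hform g hg
  obtain ⟨ν, hν, hνα⟩ := exists_mem_support_of_topWeight_eq_coe (htop α)
  have hle := topWeight_le_coe_iff.mp (htop α).le
  have hνS := mem_standardMonomials_of_mem_support_normalForm hν
  refine Set.ncard_eq_two.mpr ⟨α, ν, fun h => hα (h ▸ hνS), Set.ext fun η => ?_⟩
  simp only [Set.mem_ofPred_eq, mem_support_monomial_sub_normalForm_iff hα, forall_eq_or_imp,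
    Set.mem_insert_iff, Set.mem_singleton_iff]
  constructor
  · rintro ⟨rfl | hη, hαη, -⟩
    · exact .inl rfl
    · exact .inr (hinj (mem_standardMonomials_of_mem_support_normalForm hη) hνS
        (((hle η hη).antisymm hαη).trans hνα.symm))
  · rintro (rfl | rfl)
    · exact ⟨.inl rfl, le_rfl, hle⟩
    · exact ⟨.inr hν, hνα.ge, fun β hβ => (hle β hβ).trans hνα.ge⟩

end GeilPellikaan

namespace IsOrderFunction

variable {F : Type*} [Field F] {R : Type*} [CommRing R] [Algebra F R]
  {S : Type*} [AddCommMonoid S] [LinearOrder S] {ρ : R → WithBot S}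
  {s : ℕ} {γ : Fin s → S} {x : Fin s → R}

theorem topWeight_normalForm_ker_monomial (hS : IsWellOrderedSemigroup S)
    (h : IsOrderFunction F ρ) (hx : ∀ i, ρ (x i) = γ i) (τ : MonomialOrder (Fin s))
    (α : Fin s →₀ ℕ) :
    topWeight γ (normalForm (weightOrder hS γ τ) (RingHom.ker (aeval (R := F) x))
      (monomial α 1)) = monWeight γ α := by
  have := hS.isOrderedCancelAddMonoid
  refine (topWeight_normalForm_monomial_le α).antisymm (not_lt.mp fun hlt => ?_)
  have hρ := h.aeval_mem_ltSubmodule hx (topWeight_lt_coe_iff.mp hlt)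
  have hker := sub_normalForm_mem (m := weightOrder hS γ τ) (I := RingHom.ker (aeval (R := F) x))
    (monomial α 1)
  rw [RingHom.mem_ker, map_sub, sub_eq_zero] at hker
  rw [← hker, mem_ltSubmodule, h.map_aeval_monomial hx] at hρ
  exact hρ.ne rfl

theorem injOn_monWeight_standardMonomials_ker (hS : IsWellOrderedSemigroup S)
    (h : IsOrderFunction F ρ) (hγ : AddSubmonoid.closure (Set.range γ) = ⊤)
    (hx : ∀ i, ρ (x i) = γ i) (τ : MonomialOrder (Fin s)) :
    (standardMonomials (weightOrder hS γ τ) (RingHom.ker (aeval (R := F) x))).InjOn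
      (monWeight γ) := by
  have := hS.isOrderedCancelAddMonoid
  have := hS.wellFoundedLT
  intro α hα β hβ hw
  by_contra hne
  obtain ⟨c, -, hc⟩ := h.exists_sub_lt (aeval x (monomial α (1 : F)))
    (aeval x (monomial β (1 : F))) (by rw [h.map_aeval_monomial hx, h.map_aeval_monomial hx, hw])
    (by rw [h.map_aeval_monomial hx]; exact WithBot.coe_ne_bot)
  rw [h.map_aeval_monomial hx] at hc
  obtain ⟨f, hf, hfx⟩ := h.exists_mem_weightLT_aeval_eq hγ hx hc
  have hstd : monomial α 1 - c • monomial β 1 ∈ restrictSupport F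
      (standardMonomials (weightOrder hS γ τ) (RingHom.ker (aeval (R := F) x))) :=
    sub_mem ((monomial_mem_restrictSupport F).mpr (.inl hα))
      (Submodule.smul_mem _ c ((monomial_mem_restrictSupport F).mpr (.inl hβ)))
  have hker : f - (monomial α 1 - c • monomial β 1) ∈ RingHom.ker (aeval (R := F) x) := by
    rw [RingHom.mem_ker, map_sub, hfx, map_sub, map_smul, sub_self]
  have hlow := normalForm_mem_weightLT (hS := hS) (τ := τ)
    (I := RingHom.ker (aeval (R := F) x)) hf
  rw [normalForm_eq_of_sub_mem hker, normalForm_eq_self hstd] at hlow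
  refine (mem_weightLT.mp hlow α ?_).ne rfl
  classical
  simp [mem_support_iff, coeff_monomial, Ne.symm hne]

theorem isGeilPellikaanForm_ker (hS : IsWellOrderedSemigroup S)
    (h : IsOrderFunction F ρ) (hγ : AddSubmonoid.closure (Set.range γ) = ⊤)
    (hx : ∀ i, ρ (x i) = γ i) (τ : MonomialOrder (Fin s)) :
    IsGeilPellikaanForm hS γ τ (RingHom.ker (aeval (R := F) x)) :=
  isGeilPellikaanForm_of_topWeight_normalForm_monomial
    (h.injOn_monWeight_standardMonomials_ker hS hγ hx τ)
    (h.topWeight_normalForm_ker_monomial hS hx τ)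

theorem exists_isGeilPellikaanForm_algEquiv_quotient (hS : IsWellOrderedSemigroup S)
    (h : IsOrderFunction F ρ) (hγ : AddSubmonoid.closure (Set.range γ) = ⊤)
    (τ : MonomialOrder (Fin s)) :
    ∃ I : Ideal (MvPolynomial (Fin s) F), IsGeilPellikaanForm hS γ τ I ∧
      Nonempty (R ≃ₐ[F] (MvPolynomial (Fin s) F ⧸ I)) := by
  have := hS.isOrderedCancelAddMonoid
  have := hS.wellFoundedLT
  choose x hx using fun i => h.surjective (γ i)
  exact ⟨_, h.isGeilPellikaanForm_ker hS hγ hx τ,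
    ⟨(Ideal.quotientKerAlgEquivOfSurjective (h.aeval_surjective hγ hx)).symm⟩⟩

end IsOrderFunction

section StandardWeight

variable {F : Type*} [Field F] {S : Type*} [AddCommMonoid S] [LinearOrder S]
  {s : ℕ} {γ : Fin s → S} {m : MonomialOrder (Fin s)} {I : Ideal (MvPolynomial (Fin s) F)}

/-- The function on the quotient by `I` that takes a residue class to the maximal weight of a
monomial of its standard representative. It is the order function of the converse direction. -/
noncomputable def standardWeight (γ : Fin s → S) (m : MonomialOrder (Fin s))
    (I : Ideal (MvPolynomial (Fin s) F)) (a : MvPolynomial (Fin s) F ⧸ I) : WithBot S :=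
  topWeight γ (normalForm m I a.out)

theorem standardWeight_mk (f : MvPolynomial (Fin s) F) :
    standardWeight γ m I (Ideal.Quotient.mk I f) = topWeight γ (normalForm m I f) := by
  rw [standardWeight, normalForm_eq_of_sub_mem (Ideal.Quotient.eq.mp (Ideal.Quotient.mk_out _))]

theorem standardWeight_mk_eq_topWeight {f : MvPolynomial (Fin s) F}
    (hf : f ∈ restrictSupport F (standardMonomials m I)) :
    standardWeight γ m I (Ideal.Quotient.mk I f) = topWeight γ f := by
  rw [standardWeight_mk, normalForm_eq_self hf]

theorem exists_mem_restrictSupport_mk_eq (m : MonomialOrder (Fin s))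
    (a : MvPolynomial (Fin s) F ⧸ I) :
    ∃ f ∈ restrictSupport F (standardMonomials m I), Ideal.Quotient.mk I f = a := by
  obtain ⟨f, rfl⟩ := Ideal.Quotient.mk_surjective a
  exact ⟨normalForm m I f, normalForm_mem_restrictSupport f,
    (Ideal.Quotient.eq.mpr (sub_normalForm_mem f)).symm⟩

theorem standardWeight_eq_bot_iff (a : MvPolynomial (Fin s) F ⧸ I) :
    standardWeight γ m I a = ⊥ ↔ a = 0 := by
  obtain ⟨f, rfl⟩ := Ideal.Quotient.mk_surjective a
  rw [standardWeight_mk, topWeight_eq_bot_iff, normalForm_eq_zero_iff,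
    Ideal.Quotient.eq_zero_iff_mem]

theorem standardWeight_smul {c : F} (hc : c ≠ 0) (a : MvPolynomial (Fin s) F ⧸ I) :
    standardWeight γ m I (c • a) = standardWeight γ m I a := by
  obtain ⟨f, rfl⟩ := Ideal.Quotient.mk_surjective a
  have hcf : c • Ideal.Quotient.mk I f = Ideal.Quotient.mk I (c • f) := rfl
  rw [hcf, standardWeight_mk, standardWeight_mk, map_smul, topWeight_smul hc]

theorem standardWeight_add_le (a b : MvPolynomial (Fin s) F ⧸ I) :
    standardWeight γ m I (a + b) ≤ max (standardWeight γ m I a) (standardWeight γ m I b) := by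
  obtain ⟨f, rfl⟩ := Ideal.Quotient.mk_surjective a
  obtain ⟨g, rfl⟩ := Ideal.Quotient.mk_surjective b
  simp only [← map_add (Ideal.Quotient.mk I), standardWeight_mk]
  rw [map_add]
  exact topWeight_add_le _ _

theorem exists_standardWeight_sub_smul_lt (hinj : (standardMonomials m I).InjOn (monWeight γ))
    {a b : MvPolynomial (Fin s) F ⧸ I} (hab : standardWeight γ m I a = standardWeight γ m I b)
    (ha : standardWeight γ m I a ≠ ⊥) :
    ∃ c : F, c ≠ 0 ∧ standardWeight γ m I (a - c • b) < standardWeight γ m I a := by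
  obtain ⟨f, hf, rfl⟩ := exists_mem_restrictSupport_mk_eq m a
  obtain ⟨g, hg, rfl⟩ := exists_mem_restrictSupport_mk_eq m b
  rw [standardWeight_mk_eq_topWeight hf] at ha hab ⊢
  rw [standardWeight_mk_eq_topWeight hg] at hab
  obtain ⟨w, hw⟩ := WithBot.ne_bot_iff_exists.mp ha
  obtain ⟨δ, hδf, hδ⟩ := exists_mem_support_of_topWeight_eq_coe hw.symm
  obtain ⟨ε, hεg, hε⟩ := exists_mem_support_of_topWeight_eq_coe (hab.symm.trans hw.symm)
  obtain rfl := hinj (hf hδf) (hg hεg) (hδ.trans hε.symm)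
  subst hδ
  set c := f.coeff δ / g.coeff δ
  have hcg : c * g.coeff δ = f.coeff δ := div_mul_cancel₀ _ (mem_support_iff.mp hεg)
  have hlow : f - c • g ∈ weightLT F γ (monWeight γ δ) := by
    have hsub : f - c • g =
        (f - monomial δ (f.coeff δ)) - c • (g - monomial δ (g.coeff δ)) := by
      rw [smul_sub, smul_monomial, smul_eq_mul, hcg, sub_sub_sub_cancel_right]
    rw [hsub]
    exact sub_mem (sub_monomial_mem_weightLT hinj hf (hf hδf) hw.ge)
      (Submodule.smul_mem _ c
        (sub_monomial_mem_weightLT hinj hg (hg hεg) (hab.symm.trans hw.symm).le))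
  refine ⟨c, div_ne_zero (mem_support_iff.mp hδf) (mem_support_iff.mp hεg), ?_⟩
  have hmk : Ideal.Quotient.mk I f - c • Ideal.Quotient.mk I g =
    Ideal.Quotient.mk I (f - c • g) := rfl
  rw [hmk, standardWeight_mk_eq_topWeight (sub_mem hf (Submodule.smul_mem _ c hg)), ← hw]
  exact topWeight_lt_coe_iff.mpr hlow

end StandardWeight

namespace IsGeilPellikaanForm

variable {F : Type*} [Field F] {S : Type*} [AddCommMonoid S] [LinearOrder S]
  {hS : IsWellOrderedSemigroup S} {s : ℕ} {γ : Fin s → S} {τ : MonomialOrder (Fin s)}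
  {I : Ideal (MvPolynomial (Fin s) F)}

theorem standardWeight_mul (hI : IsGeilPellikaanForm hS γ τ I)
    (a b : MvPolynomial (Fin s) F ⧸ I) :
    standardWeight γ (weightOrder hS γ τ) I (a * b) =
      standardWeight γ (weightOrder hS γ τ) I a + standardWeight γ (weightOrder hS γ τ) I b := by
  have := hS.isOrderedCancelAddMonoid
  rcases eq_or_ne a 0 with rfl | ha
  · rw [zero_mul, (standardWeight_eq_bot_iff _).mpr rfl, WithBot.bot_add]
  rcases eq_or_ne b 0 with rfl | hb
  · rw [mul_zero, (standardWeight_eq_bot_iff _).mpr rfl, WithBot.add_bot]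
  rw [Ne, ← standardWeight_eq_bot_iff (γ := γ) (m := weightOrder hS γ τ)] at ha hb
  obtain ⟨f, hf, rfl⟩ := exists_mem_restrictSupport_mk_eq (weightOrder hS γ τ) a
  obtain ⟨g, hg, rfl⟩ := exists_mem_restrictSupport_mk_eq (weightOrder hS γ τ) b
  rw [standardWeight_mk_eq_topWeight hf] at ha ⊢
  rw [standardWeight_mk_eq_topWeight hg] at hb ⊢
  obtain ⟨v, hv⟩ := WithBot.ne_bot_iff_exists.mp ha
  obtain ⟨w, hw⟩ := WithBot.ne_bot_iff_exists.mp hb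
  obtain ⟨δ, hδ, rfl⟩ := exists_mem_support_of_topWeight_eq_coe hv.symm
  obtain ⟨ε, hε, rfl⟩ := exists_mem_support_of_topWeight_eq_coe hw.symm
  have htop := topWeight_normalForm_eq
    (mul_ne_zero (mem_support_iff.mp hδ) (mem_support_iff.mp hε))
    (hI.topWeight_normalForm_monomial (δ + ε))
    (mul_sub_monomial_mem_weightLT (sub_monomial_mem_weightLT hI.2 hf (hf hδ) hv.ge)
      (sub_monomial_mem_weightLT hI.2 hg (hg hε) hw.ge))
  rw [← map_mul, standardWeight_mk, htop, ← hv, ← hw, map_add, WithBot.coe_add]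

theorem isOrderFunction_standardWeight (hI : IsGeilPellikaanForm hS γ τ I)
    (hγ : AddSubmonoid.closure (Set.range γ) = ⊤) :
    IsOrderFunction F (standardWeight γ (weightOrder hS γ τ) I) where
  surjective
    | ⊥ => ⟨0, (standardWeight_eq_bot_iff 0).mpr rfl⟩
    | (w : S) => by
      obtain ⟨α, rfl⟩ := monWeight_surjective hγ w
      exact ⟨Ideal.Quotient.mk I (monomial α 1),
        (standardWeight_mk _).trans (hI.topWeight_normalForm_monomial α)⟩
  eq_bot_iff := standardWeight_eq_bot_iff
  smul _ a hc := standardWeight_smul hc a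
  add_le := standardWeight_add_le
  exists_sub_lt _ _ := exists_standardWeight_sub_smul_lt hI.2
  mul := hI.standardWeight_mul

theorem exists_isOrderFunction (hI : IsGeilPellikaanForm hS γ τ I)
    (hγ : AddSubmonoid.closure (Set.range γ) = ⊤) :
    ∃ ρ : MvPolynomial (Fin s) F ⧸ I → WithBot S, IsOrderFunction F ρ ∧ IsMaxWeight hS γ τ I ρ :=
  ⟨_, hI.isOrderFunction_standardWeight hγ, fun _ hf => standardWeight_mk_eq_topWeight hf⟩

end IsGeilPellikaanForm

theorem exists_toricIdeal_quotient_algEquiv_toricAlgebra {F : Type*} [Field F] {r s : ℕ}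
    {Γ : AddSubmonoid (Fin r → ℕ)} {γ : Fin s → Γ}
    (hγ : AddSubmonoid.closure (Set.range γ) = ⊤) :
    ∃ e : (MvPolynomial (Fin s) F ⧸ toricIdeal F γ) ≃ₐ[F] toricAlgebra F Γ,
      ∀ i, (e (Ideal.Quotient.mk _ (X i)) : MvPolynomial (Fin r) F) = toricMonomial F (γ i) := by
  rw [← ker_weightAlgHom]
  refine ⟨(Ideal.quotientKerAlgEquivOfSurjective (weightAlgHom_surjective hγ)).trans
    (toricAlgEquiv F Γ), fun i => ?_⟩
  rw [← coe_toricAlgEquiv_single_one, ← weightAlgHom_X]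
  rfl

theorem mainTheorem1_general {F : Type*} [Field F] {r : ℕ} (Γ : AddSubmonoid (Fin r → ℕ))
    (hfg : Γ.FG) [LinearOrder Γ] (hΓ : IsWellOrderedSemigroup Γ) :
    (∀ (R : Type*) [CommRing R] [Algebra F R] (ρ : R → WithBot Γ), IsOrderFunction F ρ →
      HasFlatDeformation F R (toricAlgebra F Γ)) ∧
    ∀ (s : ℕ) (γ : Fin s → Γ), AddSubmonoid.closure (Set.range γ) = ⊤ →
      (∃ e : (MvPolynomial (Fin s) F ⧸ toricIdeal F γ) ≃ₐ[F] toricAlgebra F Γ,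
        ∀ i, (e (Ideal.Quotient.mk _ (MvPolynomial.X i)) : MvPolynomial (Fin r) F) =
          toricMonomial F (γ i : Fin r → ℕ)) ∧
      ∀ τ : MonomialOrder (Fin s),
        (∀ (R : Type*) [CommRing R] [Algebra F R] (ρ : R → WithBot Γ), IsOrderFunction F ρ →
          ∃ I : Ideal (MvPolynomial (Fin s) F), IsGeilPellikaanForm hΓ γ τ I ∧
            Nonempty (R ≃ₐ[F] (MvPolynomial (Fin s) F ⧸ I))) ∧
        (∀ I : Ideal (MvPolynomial (Fin s) F), IsGeilPellikaanForm hΓ γ τ I →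
          ∃ ρ : MvPolynomial (Fin s) F ⧸ I → WithBot Γ,
            IsOrderFunction F ρ ∧ IsMaxWeight hΓ γ τ I ρ) := by
  have := hΓ.isOrderedCancelAddMonoid
  have := hΓ.wellFoundedLT
  have : AddMonoid.FG Γ := (AddMonoid.fg_iff_addSubmonoid_fg Γ).mpr hfg
  refine ⟨fun R _ _ ρ hρ => hρ.hasFlatDeformation.congr_right (toricAlgEquiv F Γ),
    fun s γ hγ => ⟨exists_toricIdeal_quotient_algEquiv_toricAlgebra hγ, fun τ => ⟨?_, ?_⟩⟩⟩
  · exact fun R _ _ ρ hρ => hρ.exists_isGeilPellikaanForm_algEquiv_quotient hΓ hγ τ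
  · exact fun I hI => hI.exists_isOrderFunction hγ

theorem mainTheorem1 {F : Type*} [Field F] [Finite F] {r : ℕ} (Γ : AddSubmonoid (Fin r → ℕ))
    (hfg : Γ.FG) [LinearOrder Γ] (hΓ : IsWellOrderedSemigroup Γ) :
    -- every order domain with value semigroup `Γ` has a flat deformation to `R_Γ`
    (∀ (R : Type*) [CommRing R] [Algebra F R] (ρ : R → WithBot Γ), IsOrderFunction F ρ →
      HasFlatDeformation F R (toricAlgebra F Γ)) ∧
    -- for generators `γ₁, …, γ_s` of `Γ` (the columns of `M`)
    ∀ (s : ℕ) (γ : Fin s → Γ), AddSubmonoid.closure (Set.range γ) = ⊤ →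
      -- `F[X₁, …, X_s] / I_Γ ≅ R_Γ`, with `X_i` going to `T^{γ_i}`
      (∃ e : (MvPolynomial (Fin s) F ⧸ toricIdeal F γ) ≃ₐ[F] toricAlgebra F Γ,
        ∀ i, (e (Ideal.Quotient.mk _ (MvPolynomial.X i)) : MvPolynomial (Fin r) F) =
          toricMonomial F (γ i : Fin r → ℕ)) ∧
      ∀ τ : MonomialOrder (Fin s),
        -- the order domains with value semigroup `Γ` have presentations of Gröbner basis form
        (∀ (R : Type*) [CommRing R] [Algebra F R] (ρ : R → WithBot Γ), IsOrderFunction F ρ →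
          ∃ I : Ideal (MvPolynomial (Fin s) F), IsGeilPellikaanForm hΓ γ τ I ∧
            Nonempty (R ≃ₐ[F] (MvPolynomial (Fin s) F ⧸ I))) ∧
        -- conversely, the algebras of this form are order domains with value semigroup `Γ`
        (∀ I : Ideal (MvPolynomial (Fin s) F), IsGeilPellikaanForm hΓ γ τ I →
          ∃ ρ : MvPolynomial (Fin s) F ⧸ I → WithBot Γ,
            IsOrderFunction F ρ ∧ IsMaxWeight hΓ γ τ I ρ) := by
  exact mainTheorem1_general Γ hfg hΓ
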